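/- Let $n\ge 0$ and let $B\in GL_n(\mathbb C(x))$. The system $Y(x-1)=B(x)Y(x)$ is called Fuchsian if it can be written $(x-1)\bigl(Y(x)-Y(x-1)\bigr)=A(x)Y(x)$, that is $B=I-\frac{1}{x-1}A$, with $A\in M_n(\mathbb C(x))$ holomorphic at $\infty$; it is called regular singular if there is $R\in GL_n(\mathbb C(x))$ such that the system with matrix $R(x-1)^{-1}B(x)R(x)$ is Fuchsian. Let $\mathcal O_{fact}$ be the ring of sums of factorial series $\sum_{s\ge 0}a_s\,\frac{1}{x(x+1)\cdots(x+s-1)}$, $a_s\in\mathbb C$, that converge in some right half-plane, and let $\mathcal M_{fact}(\mathbb C)$ be the field of those elements of the fraction field of $\mathcal O_{fact}$ that are meromorphic on all of $\mathbb C$. For $c\in\mathbb C$ and $k\in\mathbb N$ put $$l^{(k)}_c(x)=\frac1{k!}\,\frac{\partial^k}{\partial c'^k}\Big|_{c'=c}\frac{\Gamma(x)}{\Gamma(x-c')},$$ and for $\mu\ge 1$ let $e^+_{cI_\mu+N_\mu}$ be the $\mu\times\mu$ upper triangular matrix whose entry in position $(a,b)$ is $l^{(b-a)}_c$ if $a\le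 b$ and $0$ otherwise. Fix a (strict) total order $\prec$ on the set $\mathbb C$ (for instance the lexicographic order on real and imaginary parts). A log-car matrix in normal form is a block diagonal $n\times n$ matrix $N$ with successive diagonal blocks $e^+_{c_iI_{\mu_i}+N_{\mu_i}}$, $1\le i\le m$, where $\mu_i\ge1$, $0<\mathrm{Re}(c_i)\le 1$, and, for $i<j$, either $c_i\prec c_j$, or $c_i=c_j$ and $\mu_i\le\mu_j$. A solution at $+\infty$ in normal form of a regular singular system $Y(x-1)=B(x)Y(x)$ is a matrix $Y$ of meromorphic functions on $\mathbb C$ satisfying the system, together with a factorization $Y=MN$ where $M\in GL_n(\mathcal M_{fact}(\mathbb C))$ and $N$ is a log-car matrix in normal form. Theorem. Let $Y=MN$ and $Y'=M'N'$ be two solutions at $+\infty$ in normal form of the same regular singular system (for the same order $\prec$). Then $N'=N$, and there is a constant matrix $R\in GL_n(\mathbb C)$ that commutes with $N$ such that $M'=MR$. -/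

import Mathlib

open Filter
open scoped Polynomial

noncomputable section

namespace DifferenceSystem

/-! ### Rational difference systems

A system is `Y(x-1) = B(x) Y(x)` with `B ∈ GL_n(ℂ(x))`. -/

/-- The translation `r(x) ↦ r(x - 1)` on the field `ℂ(x)`. -/
def ratShift : RatFunc ℂ →+* RatFunc ℂ :=
  RatFunc.mapRingHom (Polynomial.taylorEquiv (-1 : ℂ))
    (nonZeroDivisors_le_comap_nonZeroDivisors_of_injective _
      (Polynomial.taylorEquiv (-1 : ℂ)).injective)

/-- The gauge transform `R(x-1)⁻¹ B(x) R(x)` of the system `Y(x-1) = B(x) Y(x)`: it is the system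
satisfied by `Z` when `Y = R Z`. -/
def gauge {n : ℕ} (R B : GL (Fin n) (RatFunc ℂ)) : GL (Fin n) (RatFunc ℂ) :=
  (Matrix.GeneralLinearGroup.map ratShift R)⁻¹ * B * R

/-- A rational function is holomorphic at infinity. -/
def HolomorphicAtInfinity (r : RatFunc ℂ) : Prop := RatFunc.intDegree r ≤ 0

/-- `Y(x-1) = B(x) Y(x)` is Fuchsian: it can be written
`(x - 1) (Y(x) - Y(x-1)) = A(x) Y(x)`, that is `B = I - A / (x - 1)`, for a rational
matrix `A` holomorphic at infinity. -/
def IsFuchsian {n : ℕ} (B : GL (Fin n) (RatFunc ℂ)) : Prop :=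
  ∃ A : Matrix (Fin n) (Fin n) (RatFunc ℂ),
    (∀ i j, HolomorphicAtInfinity (A i j)) ∧
    (B : Matrix (Fin n) (Fin n) (RatFunc ℂ)) = 1 - ((RatFunc.X : RatFunc ℂ) - 1)⁻¹ • A

/-- `Y(x-1) = B(x) Y(x)` is regular singular: some rational gauge transformation makes it
Fuchsian. -/
def IsRegularSingular {n : ℕ} (B : GL (Fin n) (RatFunc ℂ)) : Prop :=
  ∃ R : GL (Fin n) (RatFunc ℂ), IsFuchsian (gauge R B)

/-! ### Meromorphic functions

A meromorphic function on `ℂ` is represented by a function `ℂ → ℂ`, and equality of meromorphic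
functions is equality off a closed discrete subset of `ℂ` (the filter `codiscrete ℂ`). -/

/-- `Y` solves `Y(x-1) = B(x) Y(x)` as a matrix of meromorphic functions. -/
def IsSolution {n : ℕ} (B : GL (Fin n) (RatFunc ℂ)) (Y : ℂ → Matrix (Fin n) (Fin n) ℂ) : Prop :=
  (∀ i j, Meromorphic fun x => Y x i j) ∧
  ∀ᶠ x in codiscrete ℂ,
    Y (x - 1) =
      (B : Matrix (Fin n) (Fin n) (RatFunc ℂ)).map (RatFunc.eval (RingHom.id ℂ) x) * Y x

/-! ### Factorial series -/

/-- `x^{-[s]} = 1 / (x (x+1) ⋯ (x+s-1))`. -/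
def negFactPow (s : ℕ) (x : ℂ) : ℂ := (∏ k ∈ Finset.range s, (x + k))⁻¹

/-- On the half-plane `Re x > σ`, `f` is the sum of a convergent factorial series
`∑ a_s x^{-[s]}`. (Ordinary convergence at a point `x₀` which is not a pole implies absolute
convergence for `Re x > Re x₀ + 1`, so asking for summability on a half-plane that may be shrunk is
the same as asking for convergence of partial sums.) -/
def IsFactorialSeriesOn (σ : ℝ) (f : ℂ → ℂ) : Prop :=
  ∃ a : ℕ → ℂ, ∀ x : ℂ, σ < x.re → HasSum (fun s => a s * negFactPow s x) (f x)

/-- `f ∈ 𝓜_fact(ℂ)`: `f` is meromorphic on the whole of `ℂ`, and on some right half-plane it is a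
quotient `g / h` of two sums of convergent factorial series, with `h` not identically zero. -/
def IsMFact (f : ℂ → ℂ) : Prop :=
  Meromorphic f ∧
  ∃ σ : ℝ, 0 ≤ σ ∧ ∃ g h : ℂ → ℂ,
    IsFactorialSeriesOn σ g ∧ IsFactorialSeriesOn σ h ∧ (∃ x : ℂ, σ < x.re ∧ h x ≠ 0) ∧
    ∀ᶠ x in codiscrete ℂ, σ < x.re → f x * h x = g x

/-- `M ∈ GL_n(𝓜_fact(ℂ))`: the entries of `M` lie in `𝓜_fact(ℂ)` and `M` has an inverse, as a
matrix of meromorphic functions, with entries in `𝓜_fact(ℂ)`. -/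
def IsGLMFact {n : ℕ} (M : ℂ → Matrix (Fin n) (Fin n) ℂ) : Prop :=
  (∀ i j, IsMFact fun x => M x i j) ∧
  ∃ M' : ℂ → Matrix (Fin n) (Fin n) ℂ, (∀ i j, IsMFact fun x => M' x i j) ∧
    ∀ᶠ x in codiscrete ℂ, M x * M' x = 1 ∧ M' x * M x = 1

/-! ### Characters, logarithms and log-car matrices -/

/-- The character `e_c(x) = Γ(x) / Γ(x - c)`. -/
def character (c x : ℂ) : ℂ := Complex.Gamma x / Complex.Gamma (x - c)

/-- `l_c^{(k)}(x) = (1 / k!) ∂^k/∂c'^k e_{c'}(x)` at `c' = c`. (For fixed `x` outside the poles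
of `Γ`, the function `c' ↦ e_{c'}(x)` is entire.) -/
def logFun (k : ℕ) (c x : ℂ) : ℂ :=
  (k.factorial : ℂ)⁻¹ * iteratedDeriv k (fun c' => character c' x) c

/-- The upper triangular Toeplitz block `e_{cI + N_μ}`, with entry `l_c^{(b-a)}` in position
`(a, b)`, `a ≤ b`. -/
def logCarBlock (c : ℂ) (μ : ℕ) (x : ℂ) : Matrix (Fin μ) (Fin μ) ℂ :=
  Matrix.of fun a b => if a ≤ b then logFun ((b : ℕ) - (a : ℕ)) c x else 0

/-- Jordan data in normal form, of total size `n`, for a strict total order `lt` on `ℂ`: a finite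
sequence of blocks `(c_i, μ_i)`, `μ_i ≥ 1`, with `0 < Re c_i ≤ 1`, in which the `c_i` increase and
blocks with the same `c_i` are arranged by increasing size. -/
structure JordanData (lt : ℂ → ℂ → Prop) (n : ℕ) where
  m : ℕ
  c : Fin m → ℂ
  μ : Fin m → ℕ
  μ_pos : ∀ i, 0 < μ i
  sum_μ : ∑ i, μ i = n
  c_mem : ∀ i, 0 < (c i).re ∧ (c i).re ≤ 1
  sorted : ∀ i j, i < j → lt (c i) (c j) ∨ (c i = c j ∧ μ i ≤ μ j)

/-- The block diagonal matrix with diagonal blocks `e_{c_i I + N_{μ_i}}`, in order. -/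
def JordanData.logCar {lt : ℂ → ℂ → Prop} {n : ℕ} (J : JordanData lt n) (x : ℂ) :
    Matrix (Fin n) (Fin n) ℂ :=
  Matrix.reindex (finSigmaFinEquiv.trans (finCongr J.sum_μ))
    (finSigmaFinEquiv.trans (finCongr J.sum_μ))
    (Matrix.blockDiagonal' fun i => logCarBlock (J.c i) (J.μ i) x)

/-- `N` is a log-car matrix in normal form. -/
def IsNormalLogCar (lt : ℂ → ℂ → Prop) {n : ℕ} (N : ℂ → Matrix (Fin n) (Fin n) ℂ) : Prop :=
  ∃ J : JordanData lt n, N =ᶠ[codiscrete ℂ] J.logCar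

/-- `Y = M N` is a solution at `+∞` in normal form of `Y(x-1) = B(x) Y(x)`. -/
structure IsNormalFormSolution (lt : ℂ → ℂ → Prop) {n : ℕ} (B : GL (Fin n) (RatFunc ℂ))
    (Y M N : ℂ → Matrix (Fin n) (Fin n) ℂ) : Prop where
  solution : IsSolution B Y
  factorization : Y =ᶠ[codiscrete ℂ] fun x => M x * N x
  left_mem : IsGLMFact M
  right_mem : IsNormalLogCar lt N

end DifferenceSystem

end

noncomputable section

namespace DifferenceSystem

open Asymptotics Topology

/-! Let `J`, `J'` be the Jordan matrices behind `N`, `N'`, so that (x - 1) N(x - 1) = ((x - 1) - J)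
N(x), and put Q = M⁻¹ M'. Eliminating `B` gives Q(x - 1) ((x - 1) - J') = ((x - 1) - J) Q(x). The
theorem follows once Q is known to be a constant matrix C.

Factorial series have asymptotic expansions in x⁻¹, so the entries of Q have Laurent expansions
(`exists_hasPoleExpansion_mul`). If the leading term is x^j B₀, then J B₀ - B₀ J' = j B₀
(`sylvester_of_tendsto`). The eigenvalues have real part in (0, 1], so no two differ by a nonzero
integer, and only j = 0 survives. Subtracting the constant coefficient C, which satisfies J C = C
J', and repeating the argument shows that Q - C is flat (`exists_hasExpansion_zero`). A flat
solution vanishes: the equation bounds its decay along x, x + 1, x + 2, … by a fixed power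
(`eventually_eq_zero_of_hasExpansion_zero`).

Thus C is invertible and makes `J` and `J'` similar. Kernel dimensions of powers count the Jordan
blocks, and the ordering convention makes the data equal (`eq_of_intertwine`). Finally C commutes
with the Jordan matrix, hence with its eigenvalue part and its nilpotent part, hence with `N`
(`commute_logCar`).

Identities are handled off countable sets, which are stable under countably many translations;
meromorphy restores codiscreteness for M' = M C. -/

/-! ### The filter of points going to the right, off countable sets -/

/-- Points with real part going to `+∞`, off countable sets. -/
def rightInfinity : Filter ℂ := comap Complex.re atTop ⊓ cocountable

/-- A discrete closed subset of a hereditarily Lindelöf space is countable. -/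
theorem cocountable_le_codiscrete : (cocountable : Filter ℂ) ≤ codiscrete ℂ := by
  intro s hs
  rw [mem_cocountable]
  have h : IsDiscrete (sᶜ ∩ Set.univ) := isDiscrete_of_codiscreteWithin (by rw [compl_compl]; exact hs)
  rw [Set.inter_univ] at h
  exact (HereditarilyLindelofSpace.isLindelof _).countable_of_isDiscrete h

theorem rightInfinity_le_cocountable : rightInfinity ≤ cocountable := inf_le_right

theorem eventually_re_gt (r : ℝ) : ∀ᶠ x in rightInfinity, r < x.re :=
  inf_le_left (a := comap Complex.re atTop) ((eventually_gt_atTop r).comap _)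

theorem tendsto_re_rightInfinity : Tendsto Complex.re rightInfinity atTop :=
  tendsto_comap.mono_left inf_le_left

theorem eventually_cocountable_sub {p : ℂ → Prop} (h : ∀ᶠ x in cocountable, p x) (c : ℂ) :
    ∀ᶠ x in (cocountable : Filter ℂ), p (x - c) := by
  rw [Filter.Eventually, mem_cocountable] at h ⊢
  refine (h.image (fun x => x + c)).mono fun x hx => ?_
  exact ⟨x - c, hx, by simp⟩

theorem eventually_cocountable_ne (c : ℂ) : ∀ᶠ x in (cocountable : Filter ℂ), x ≠ c := by
  rw [Filter.Eventually, mem_cocountable]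
  exact (Set.countable_singleton c).mono fun x hx => by simpa using hx

theorem tendsto_sub_one_rightInfinity : Tendsto (fun x : ℂ => x - 1) rightInfinity rightInfinity := by
  refine tendsto_inf.2 ⟨tendsto_comap_iff.2 ?_, ?_⟩
  · simpa [Function.comp_def, sub_eq_add_neg] using
      tendsto_atTop_add_const_right _ (-1 : ℝ) tendsto_re_rightInfinity
  · intro s hs
    exact rightInfinity_le_cocountable (eventually_cocountable_sub hs 1)

/-- Otherwise a real half-line would be countable, hence of measure zero. -/
instance : rightInfinity.NeBot := by
  rw [rightInfinity, inf_neBot_iff]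
  intro s hs t ht
  obtain ⟨u, hu, hus⟩ := hs
  obtain ⟨r, hr⟩ := mem_atTop_sets.1 hu
  rw [mem_cocountable] at ht
  by_contra hne
  rw [Set.not_nonempty_iff_eq_empty] at hne
  have hsub : s ⊆ tᶜ := fun x hx hxt => by
    have : x ∈ s ∩ t := ⟨hx, hxt⟩
    simp [hne] at this
  have hc : (Complex.ofReal '' Set.Ici r).Countable := by
    refine ht.mono (Set.Subset.trans ?_ hsub)
    rintro _ ⟨y, hy, rfl⟩
    exact hus (hr y hy)
  have hc' : (Set.Ici r).Countable :=
    (Set.countable_of_injective_of_countable_image Complex.ofReal_injective.injOn hc)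
  have := hc'.measure_zero MeasureTheory.volume
  simp at this

theorem tendsto_norm_rightInfinity : Tendsto (fun x : ℂ => ‖x‖) rightInfinity atTop :=
  tendsto_atTop_mono Complex.re_le_norm tendsto_re_rightInfinity

theorem tendsto_inv_rightInfinity : Tendsto (fun x : ℂ => x⁻¹) rightInfinity (𝓝 0) :=
  tendsto_inv₀_cobounded.comp (tendsto_norm_atTop_iff_cobounded.1 tendsto_norm_rightInfinity)

theorem eventually_ne_rightInfinity (c : ℂ) : ∀ᶠ x in rightInfinity, x ≠ c :=
  rightInfinity_le_cocountable (eventually_cocountable_ne c)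

theorem isBigO_polynomial_inv (p : ℂ[X]) :
    (fun x : ℂ => p.eval x⁻¹) =O[rightInfinity] (fun _ => (1 : ℂ)) :=
  ((p.continuous.tendsto 0).comp tendsto_inv_rightInfinity).isBigO_one ℂ

theorem isBigO_polynomial_inv_of_dvd {p : ℂ[X]} {K : ℕ} (h : Polynomial.X ^ K ∣ p) :
    (fun x : ℂ => p.eval x⁻¹) =O[rightInfinity] (fun x => x⁻¹ ^ K) := by
  obtain ⟨q, rfl⟩ := h
  simpa using (isBigO_refl (fun x : ℂ => x⁻¹ ^ K) rightInfinity).mul (isBigO_polynomial_inv q)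

theorem isBigO_inv_pow {j K : ℕ} (h : j ≤ K) :
    (fun x : ℂ => x⁻¹ ^ K) =O[rightInfinity] (fun x => x⁻¹ ^ j) := by
  simpa using isBigO_polynomial_inv_of_dvd (pow_dvd_pow (Polynomial.X : ℂ[X]) h)

/-! ### Asymptotic expansions in powers of `x⁻¹` -/

/-- `g` is the power series `q` in `x⁻¹`, modulo `O(x⁻ᴷ)`. -/
def HasExpansionMod (K : ℕ) (g : ℂ → ℂ) (q : PowerSeries ℂ) : Prop :=
  ∃ p : ℂ[X], PowerSeries.X ^ K ∣ (p : PowerSeries ℂ) - q ∧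
    (fun x => g x - p.eval x⁻¹) =O[rightInfinity] fun x => x⁻¹ ^ K

/-- `g` has the asymptotic expansion `q` in powers of `x⁻¹` at `+∞`. -/
def HasExpansion (g : ℂ → ℂ) (q : PowerSeries ℂ) : Prop := ∀ K, HasExpansionMod K g q

namespace HasExpansionMod

variable {K : ℕ} {g g₁ g₂ : ℂ → ℂ} {q q₁ q₂ : PowerSeries ℂ}

theorem isBigO_one (h : HasExpansionMod K g q) : g =O[rightInfinity] fun _ => (1 : ℂ) := by
  obtain ⟨p, -, hp⟩ := h
  have := (hp.trans (isBigO_inv_pow (Nat.zero_le K))).add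
    (by simpa using isBigO_polynomial_inv p)
  simpa using this

theorem congr_isBigO (h : HasExpansionMod K g₁ q)
    (hg : (fun x => g₂ x - g₁ x) =O[rightInfinity] fun x => x⁻¹ ^ K) :
    HasExpansionMod K g₂ q := by
  obtain ⟨p, hd, hp⟩ := h
  exact ⟨p, hd, by simpa using hg.add hp⟩

theorem congr_dvd (h : HasExpansionMod K g q₁) (hq : PowerSeries.X ^ K ∣ q₁ - q₂) :
    HasExpansionMod K g q₂ := by
  obtain ⟨p, hd, hp⟩ := h
  exact ⟨p, by simpa using dvd_add hd hq, hp⟩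

theorem add (h₁ : HasExpansionMod K g₁ q₁) (h₂ : HasExpansionMod K g₂ q₂) :
    HasExpansionMod K (fun x => g₁ x + g₂ x) (q₁ + q₂) := by
  obtain ⟨p₁, hd₁, hp₁⟩ := h₁
  obtain ⟨p₂, hd₂, hp₂⟩ := h₂
  refine ⟨p₁ + p₂, ?_, (hp₁.add hp₂).congr_left fun x => ?_⟩
  · rw [Polynomial.coe_add, add_sub_add_comm]
    exact dvd_add hd₁ hd₂
  · rw [Polynomial.eval_add]
    ring

theorem mul (h₁ : HasExpansionMod K g₁ q₁) (h₂ : HasExpansionMod K g₂ q₂) :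
    HasExpansionMod K (fun x => g₁ x * g₂ x) (q₁ * q₂) := by
  have hb := h₁.isBigO_one
  obtain ⟨p₁, hd₁, hp₁⟩ := h₁
  obtain ⟨p₂, hd₂, hp₂⟩ := h₂
  refine ⟨p₁ * p₂, ?_, ?_⟩
  · have : ((p₁ * p₂ : ℂ[X]) : PowerSeries ℂ) - q₁ * q₂ = p₁ * (p₂ - q₂) + (p₁ - q₁) * q₂ := by
      rw [Polynomial.coe_mul]
      ring
    rw [this]
    exact dvd_add (dvd_mul_of_dvd_right hd₂ _) (dvd_mul_of_dvd_left hd₁ _)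
  · have h₁ := hb.mul hp₂
    have h₂ := hp₁.mul (isBigO_polynomial_inv p₂)
    simp only [one_mul, mul_one] at h₁ h₂
    refine (h₁.add h₂).congr_left fun x => ?_
    rw [Polynomial.eval_mul]
    ring

theorem const (K : ℕ) (a : ℂ) : HasExpansionMod K (fun _ => a) (PowerSeries.C a) :=
  ⟨Polynomial.C a, by simp, by simpa using isBigO_zero _ _⟩

end HasExpansionMod

namespace HasExpansion

variable {g g₁ g₂ : ℂ → ℂ} {q q₁ q₂ : PowerSeries ℂ}

theorem add (h₁ : HasExpansion g₁ q₁) (h₂ : HasExpansion g₂ q₂) :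
    HasExpansion (fun x => g₁ x + g₂ x) (q₁ + q₂) := fun K => (h₁ K).add (h₂ K)

theorem mul (h₁ : HasExpansion g₁ q₁) (h₂ : HasExpansion g₂ q₂) :
    HasExpansion (fun x => g₁ x * g₂ x) (q₁ * q₂) := fun K => (h₁ K).mul (h₂ K)

theorem const (a : ℂ) : HasExpansion (fun _ => a) (PowerSeries.C a) :=
  fun K => HasExpansionMod.const K a

theorem congr (h : HasExpansion g₁ q) (hg : g₂ =ᶠ[rightInfinity] g₁) : HasExpansion g₂ q := by
  refine fun K => (h K).congr_isBigO ?_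
  refine (isBigO_zero _ _).congr' ?_ EventuallyEq.rfl
  filter_upwards [hg] with x hx
  simp [hx]

theorem inv_pow (s : ℕ) : HasExpansion (fun x => x⁻¹ ^ s) (PowerSeries.X ^ s) := fun K =>
  ⟨Polynomial.X ^ s, by simp, by simpa using isBigO_zero _ _⟩

theorem tendsto (h : HasExpansion g q) :
    Tendsto g rightInfinity (𝓝 (PowerSeries.constantCoeff q)) := by
  obtain ⟨p, hd, hp⟩ := h 1
  have hp0 : p.eval 0 = PowerSeries.constantCoeff q := by
    rw [pow_one, PowerSeries.X_dvd_iff, map_sub, sub_eq_zero] at hd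
    rw [← hd, Polynomial.constantCoeff_coe, Polynomial.coeff_zero_eq_eval_zero]
  have h₁ : Tendsto (fun x => g x - p.eval x⁻¹) rightInfinity (𝓝 0) :=
    hp.trans_tendsto (by simpa using tendsto_inv_rightInfinity)
  have h₂ := (p.continuous.tendsto 0).comp tendsto_inv_rightInfinity
  simpa [Function.comp_def, hp0] using h₁.add h₂

theorem inv (h : HasExpansion g q) (hq : PowerSeries.constantCoeff q ≠ 0) :
    HasExpansion (fun x => (g x)⁻¹) q⁻¹ := by
  intro K
  obtain ⟨p, hd, hp⟩ := h K
  have hr : PowerSeries.X ^ K ∣ ((PowerSeries.trunc K q⁻¹ : ℂ[X]) : PowerSeries ℂ) - q⁻¹ := by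
    rw [PowerSeries.X_pow_dvd_iff]
    intro m hm
    simp [PowerSeries.coeff_trunc, hm]
  set r := PowerSeries.trunc K q⁻¹
  refine ⟨r, hr, ?_⟩
  -- The error is g⁻¹ - r = g⁻¹ ((1 - p r) - (g - p) r), so p r ≡ 1 modulo X^K is what is needed.
  have hpr : Polynomial.X ^ K ∣ 1 - p * r := by
    have h₁ : PowerSeries.X ^ K ∣ ((1 - p * r : ℂ[X]) : PowerSeries ℂ) := by
      have : ((1 - p * r : ℂ[X]) : PowerSeries ℂ) = -((p - q) * r + q * (r - q⁻¹)) := by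
        have := PowerSeries.mul_inv_cancel q hq
        rw [Polynomial.coe_sub, Polynomial.coe_mul, Polynomial.coe_one, ← this]
        ring
      rw [this]
      exact (dvd_add (dvd_mul_of_dvd_left hd _) (dvd_mul_of_dvd_right hr _)).neg_right
    rw [PowerSeries.X_pow_dvd_iff] at h₁
    rw [Polynomial.X_pow_dvd_iff]
    intro m hm
    simpa only [Polynomial.coeff_coe] using h₁ m hm
  have hgi : (fun x => (g x)⁻¹) =O[rightInfinity] fun _ => (1 : ℂ) :=
    (h.tendsto.inv₀ hq).isBigO_one ℂ
  have h₂ := hp.mul (isBigO_polynomial_inv r)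
  simp only [mul_one] at h₂
  have h₃ := hgi.mul ((isBigO_polynomial_inv_of_dvd hpr).sub h₂)
  simp only [one_mul] at h₃
  refine h₃.congr' ?_ EventuallyEq.rfl
  filter_upwards [h.tendsto.eventually_ne hq] with x hx
  simp only [Polynomial.eval_sub, Polynomial.eval_mul, Polynomial.eval_one]
  field_simp
  ring

theorem mul_pow_of_X_pow_mul {s : ℕ} (h : HasExpansion g (PowerSeries.X ^ s * q)) :
    HasExpansion (fun x => x ^ s * g x) q := by
  intro K
  -- The extra s orders of precision pay for the factor x^s.
  obtain ⟨p, hd, hp⟩ := h (s + K)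
  have hs : Polynomial.X ^ s ∣ p := by
    have h₁ : PowerSeries.X ^ s ∣ (p : PowerSeries ℂ) := by
      have := dvd_add ((pow_dvd_pow _ (Nat.le_add_right s K)).trans hd)
        (dvd_mul_right (PowerSeries.X ^ s) q)
      simpa using this
    rw [PowerSeries.X_pow_dvd_iff] at h₁
    rw [Polynomial.X_pow_dvd_iff]
    intro m hm
    simpa only [Polynomial.coeff_coe] using h₁ m hm
  obtain ⟨p', rfl⟩ := hs
  refine ⟨p', ?_, ?_⟩
  · rw [Polynomial.coe_mul, Polynomial.coe_pow, Polynomial.coe_X, ← mul_sub, pow_add] at hd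
    exact (mul_dvd_mul_iff_left (pow_ne_zero _ PowerSeries.X_ne_zero)).1 hd
  · refine ((isBigO_refl (fun x : ℂ => x ^ s) _).mul hp).congr' ?_ ?_
    · filter_upwards [eventually_ne_rightInfinity 0] with x hx
      have : x ^ s * x⁻¹ ^ s = 1 := by rw [← mul_pow, mul_inv_cancel₀ hx, one_pow]
      simp only [Polynomial.eval_mul, Polynomial.eval_pow, Polynomial.eval_X]
      linear_combination -(p'.eval x⁻¹) * this
    · filter_upwards [eventually_ne_rightInfinity 0] with x hx
      rw [pow_add, ← mul_assoc, ← mul_pow, mul_inv_cancel₀ hx, one_pow, one_mul]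

theorem prod {ι : Type*} (s : Finset ι) {g : ι → ℂ → ℂ} {q : ι → PowerSeries ℂ}
    (h : ∀ i ∈ s, HasExpansion (g i) (q i)) :
    HasExpansion (fun x => ∏ i ∈ s, g i x) (∏ i ∈ s, q i) := by
  classical
  induction s using Finset.induction_on with
  | empty => simpa using const 1
  | insert i s hi ih =>
    simp only [Finset.prod_insert hi]
    exact (h i (Finset.mem_insert_self i s)).mul
      (ih fun j hj => h j (Finset.mem_insert_of_mem hj))

end HasExpansion

/-! ### Factorial series have asymptotic expansions -/

/-- The expansion of `1 / (x (x+1) ⋯ (x+s-1))` in powers of `x⁻¹`. -/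
def negFactPowSeries (s : ℕ) : PowerSeries ℂ :=
  PowerSeries.X ^ s * ∏ k ∈ Finset.range s, (1 + PowerSeries.C (k : ℂ) * PowerSeries.X)⁻¹

theorem hasExpansion_negFactPow (s : ℕ) :
    HasExpansion (negFactPow s) (negFactPowSeries s) := by
  refine ((HasExpansion.inv_pow s).mul (HasExpansion.prod (Finset.range s)
    (g := fun k x => (1 + (k : ℂ) * x⁻¹)⁻¹) fun k _ => ?_)).congr ?_
  · have h₁ := (HasExpansion.const 1).add ((HasExpansion.const (k : ℂ)).mul (HasExpansion.inv_pow 1))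
    simp only [pow_one, map_one] at h₁
    exact h₁.inv (by simp)
  · filter_upwards [eventually_ne_rightInfinity 0] with x hx
    rw [negFactPow, ← Finset.prod_inv_distrib,
      show x⁻¹ ^ s = ∏ _k ∈ Finset.range s, x⁻¹ by simp, ← Finset.prod_mul_distrib]
    refine Finset.prod_congr rfl fun k _ => ?_
    rw [← mul_inv, mul_add, mul_one, mul_left_comm, mul_inv_cancel₀ hx, mul_one]

theorem X_pow_dvd_negFactPowSeries {s t : ℕ} (h : s ≤ t) :
    PowerSeries.X ^ s ∣ negFactPowSeries t :=
  (pow_dvd_pow _ h).trans (dvd_mul_right _ _)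

theorem coeff_negFactPowSeries_of_lt {s t : ℕ} (h : s < t) :
    PowerSeries.coeff s (negFactPowSeries t) = 0 :=
  PowerSeries.X_pow_dvd_iff.1 (X_pow_dvd_negFactPowSeries le_rfl) s h

theorem coeff_negFactPowSeries_self (s : ℕ) :
    PowerSeries.coeff s (negFactPowSeries s) = 1 := by
  have := PowerSeries.coeff_X_pow_mul (∏ k ∈ Finset.range s,
    (1 + PowerSeries.C (k : ℂ) * PowerSeries.X)⁻¹) s 0
  rw [zero_add] at this
  rw [negFactPowSeries, this, PowerSeries.coeff_zero_eq_constantCoeff, map_prod]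
  simp

/-- Each of the first K factors satisfies |x + k| ≥ |x|, and each later one |x + k| ≥ r + k. The
product over k < K on the right cancels the first K factors of the value at r. -/
theorem norm_negFactPow_add_le {r : ℝ} (hr : 0 < r) {x : ℂ} (hx : r ≤ x.re) (K j : ℕ) :
    ‖negFactPow (K + j) x‖ ≤
      ‖x⁻¹ ^ K‖ * (‖∏ k ∈ Finset.range K, ((r : ℂ) + k)‖ * ‖negFactPow (K + j) r‖) := by
  have hx0 : 0 < ‖x‖ := hr.trans_le (hx.trans (Complex.re_le_norm x))
  have hrk : ∀ k : ℕ, ‖(r : ℂ) + k‖ = r + k := fun k => by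
    rw [← Complex.ofReal_natCast, ← Complex.ofReal_add, Complex.norm_real, Real.norm_of_nonneg]
    positivity
  simp only [negFactPow, norm_inv, norm_prod, Finset.prod_range_add, norm_mul, hrk, mul_inv, norm_pow]
  have hne : (∏ k ∈ Finset.range K, (r + k : ℝ)) ≠ 0 :=
    Finset.prod_ne_zero_iff.2 fun k _ => by positivity
  rw [mul_inv_cancel_left₀ hne]
  refine mul_le_mul ?_ ?_ (by positivity) (by positivity)
  · rw [inv_pow]
    refine inv_anti₀ (by positivity) ?_
    calc ‖x‖ ^ K = ∏ _k ∈ Finset.range K, ‖x‖ := by simp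
      _ ≤ _ := Finset.prod_le_prod (fun _ _ => hx0.le) fun k _ => by
        rw [← sq_le_sq₀ (norm_nonneg _) (norm_nonneg _), ← Complex.normSq_eq_norm_sq,
          ← Complex.normSq_eq_norm_sq, Complex.normSq_apply, Complex.normSq_apply]
        have : (0 : ℝ) ≤ k := k.cast_nonneg
        simp only [Complex.add_re, Complex.add_im, Complex.natCast_re, Complex.natCast_im]
        nlinarith
  · refine inv_anti₀ (Finset.prod_pos fun k _ => by positivity) ?_
    refine Finset.prod_le_prod (fun _ _ => by positivity) fun k _ => ?_
    refine le_trans ?_ (Complex.re_le_norm _)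
    simpa using hx

/-- Absolute convergence at the single point σ + 1 dominates the tail at every x further right,
uniformly and with the gain x⁻ᴷ. -/
theorem IsFactorialSeriesOn.isBigO_sub {σ : ℝ} (hσ : 0 ≤ σ) {f : ℂ → ℂ} {a : ℕ → ℂ}
    (h : ∀ x : ℂ, σ < x.re → HasSum (fun s => a s * negFactPow s x) (f x)) (K : ℕ) :
    (fun x => f x - ∑ s ∈ Finset.range K, a s * negFactPow s x) =O[rightInfinity]
      fun x => x⁻¹ ^ K := by
  have hr : 0 < σ + 1 := by positivity
  have hs : Summable fun j => ‖a (K + j) * negFactPow (K + j) ((σ + 1 : ℝ) : ℂ)‖ := by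
    have := (h ((σ + 1 : ℝ) : ℂ) (by simp)).summable.norm
    simpa only [add_comm] using (summable_nat_add_iff K).2 this
  set C := ‖∏ k ∈ Finset.range K, (((σ + 1 : ℝ) : ℂ) + k)‖
  refine IsBigO.of_bound (C * ∑' j, ‖a (K + j) * negFactPow (K + j) ((σ + 1 : ℝ) : ℂ)‖) ?_
  filter_upwards [eventually_re_gt (σ + 1)] with x hx
  have h₁ := (hasSum_nat_add_iff' K).2 (h x (by linarith))
  have h₂ := (hs.hasSum.mul_left C).mul_right ‖x⁻¹ ^ K‖
  refine h₁.norm_le_of_bounded h₂ fun j => ?_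
  rw [norm_mul, norm_mul, add_comm j K]
  refine (mul_le_mul_of_nonneg_left (norm_negFactPow_add_le hr hx.le K j)
    (norm_nonneg (a (K + j)))).trans_eq ?_
  ring

/-- The passage from the a_s to the coefficients of q is unitriangular, since the s-th term begins
with X^s. So each coefficient is a finite sum, and q = 0 forces every a_s to vanish; this
nonvanishing is what allows division by a denominator. -/
theorem IsFactorialSeriesOn.exists_hasExpansion {σ : ℝ} (hσ : 0 ≤ σ) {f : ℂ → ℂ}
    (hf : IsFactorialSeriesOn σ f) :
    ∃ q, HasExpansion f q ∧ ((∃ x : ℂ, σ < x.re ∧ f x ≠ 0) → q ≠ 0) := by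
  obtain ⟨a, ha⟩ := hf
  let q : PowerSeries ℂ := PowerSeries.mk fun m =>
    PowerSeries.coeff m (∑ s ∈ Finset.range (m + 1), PowerSeries.C (a s) * negFactPowSeries s)
  have hq : ∀ K, PowerSeries.X ^ K ∣
      (∑ s ∈ Finset.range K, PowerSeries.C (a s) * negFactPowSeries s) - q := by
    intro K
    rw [PowerSeries.X_pow_dvd_iff]
    intro m hm
    simp only [q, map_sub, PowerSeries.coeff_mk, map_sum, PowerSeries.coeff_C_mul]
    rw [sub_eq_zero]
    refine (Finset.sum_subset (Finset.range_mono hm) fun s _ hs => ?_).symm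
    rw [coeff_negFactPowSeries_of_lt (by simpa using hs), mul_zero]
  refine ⟨q, fun K => ?_, ?_⟩
  · refine HasExpansionMod.congr_dvd (HasExpansionMod.congr_isBigO ?_
      (IsFactorialSeriesOn.isBigO_sub hσ ha K)) (hq K)
    generalize Finset.range K = S
    induction S using Finset.induction_on with
    | empty => simpa using HasExpansionMod.const K 0
    | insert s S hs ih =>
      simp only [Finset.sum_insert hs]
      exact ((HasExpansionMod.const K (a s)).mul (hasExpansion_negFactPow s K)).add ih
  · rintro ⟨x, hx, hfx⟩ h0
    refine hfx ?_
    have hall : ∀ s, a s = 0 := by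
      intro s
      induction s using Nat.strong_induction_on with
      | _ s ih =>
        have h₁ : PowerSeries.coeff s q = 0 := by rw [h0, map_zero]
        simp only [q, PowerSeries.coeff_mk, map_sum, PowerSeries.coeff_C_mul] at h₁
        rw [Finset.sum_range_succ, Finset.sum_eq_zero fun t ht => by
          rw [ih t (Finset.mem_range.1 ht), zero_mul], coeff_negFactPowSeries_self] at h₁
        simpa using h₁
    have := ha x hx
    simp only [hall, zero_mul] at this
    exact this.unique hasSum_zero

/-! ### Elements of `𝓜_fact(ℂ)` have Laurent expansions in `x⁻¹` -/

/-- `f` has an asymptotic expansion in powers of `x⁻¹`, with a pole of order at most `N` at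
infinity. -/
def HasPoleExpansion (N : ℕ) (f : ℂ → ℂ) : Prop :=
  ∃ q, HasExpansion (fun x => x⁻¹ ^ N * f x) q

theorem HasPoleExpansion.mono {N N' : ℕ} {f : ℂ → ℂ} (h : HasPoleExpansion N f) (hN : N ≤ N') :
    HasPoleExpansion N' f := by
  obtain ⟨q, hq⟩ := h
  refine ⟨_, ((HasExpansion.inv_pow (N' - N)).mul hq).congr (.of_eq ?_)⟩
  ext x
  rw [← mul_assoc, ← pow_add, Nat.sub_add_cancel hN]

theorem HasPoleExpansion.mul {N₁ N₂ : ℕ} {f₁ f₂ : ℂ → ℂ} (h₁ : HasPoleExpansion N₁ f₁)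
    (h₂ : HasPoleExpansion N₂ f₂) : HasPoleExpansion (N₁ + N₂) fun x => f₁ x * f₂ x := by
  obtain ⟨q₁, hq₁⟩ := h₁
  obtain ⟨q₂, hq₂⟩ := h₂
  refine ⟨_, (hq₁.mul hq₂).congr (.of_eq ?_)⟩
  ext x
  rw [pow_add]
  ring

theorem HasPoleExpansion.sum {ι : Type*} (s : Finset ι) {N : ℕ} {f : ι → ℂ → ℂ}
    (h : ∀ i ∈ s, HasPoleExpansion N (f i)) : HasPoleExpansion N fun x => ∑ i ∈ s, f i x := by
  classical
  induction s using Finset.induction_on with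
  | empty => exact ⟨_, (HasExpansion.const 0).congr (.of_eq (by ext; simp))⟩
  | insert i s hi ih =>
    obtain ⟨q₁, hq₁⟩ := h i (Finset.mem_insert_self i s)
    obtain ⟨q₂, hq₂⟩ := ih fun j hj => h j (Finset.mem_insert_of_mem hj)
    refine ⟨_, (hq₁.add hq₂).congr (.of_eq ?_)⟩
    ext x
    simp only [Finset.sum_insert hi, mul_add]

theorem IsMFact.exists_hasPoleExpansion {f : ℂ → ℂ} (hf : IsMFact f) :
    ∃ N, HasPoleExpansion N f := by
  obtain ⟨-, σ, hσ, g, h, hg, hh, hne, hfh⟩ := hf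
  obtain ⟨qg, hqg, -⟩ := hg.exists_hasExpansion hσ
  obtain ⟨qh, hqh, hqh0⟩ := hh.exists_hasExpansion hσ
  have hqh0 := hqh0 hne
  set s := qh.order.toNat
  -- With s the order of the denominator, x^s h has a nonzero limit and x⁻ˢ f = g / (x^s h).
  obtain ⟨u, hu⟩ : PowerSeries.X ^ s ∣ qh := PowerSeries.X_pow_order_dvd
  have hu0 : PowerSeries.constantCoeff u ≠ 0 := by
    have h₁ := PowerSeries.coeff_order hqh0
    intro h0
    apply h₁
    have h₂ := PowerSeries.coeff_X_pow_mul u s 0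
    rw [zero_add, ← hu, PowerSeries.coeff_zero_eq_constantCoeff_apply, h0] at h₂
    exact h₂
  rw [hu] at hqh
  have hv := hqh.mul_pow_of_X_pow_mul
  refine ⟨s, _, (hqg.mul (hv.inv hu0)).congr ?_⟩
  filter_upwards [hv.tendsto.eventually_ne hu0, eventually_re_gt σ,
    rightInfinity_le_cocountable (cocountable_le_codiscrete hfh),
    eventually_ne_rightInfinity 0] with x hx hσx hfx hx0
  have hx' := mul_ne_zero_iff.1 hx
  have h₂ := hx'.2
  rw [← hfx hσx, mul_inv, inv_pow]
  field_simp

/-- The entries of a product of two matrices over `𝓜_fact(ℂ)` have Laurent expansions with a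
common bound on the poles at infinity. -/
theorem exists_hasPoleExpansion_mul {n : ℕ} {M M' : ℂ → Matrix (Fin n) (Fin n) ℂ}
    (hM : ∀ i j, IsMFact fun x => M x i j) (hM' : ∀ i j, IsMFact fun x => M' x i j) :
    ∃ N, ∀ i j, HasPoleExpansion N fun x => (M x * M' x) i j := by
  choose N hN using fun i j => (hM i j).exists_hasPoleExpansion
  choose N' hN' using fun i j => (hM' i j).exists_hasPoleExpansion
  refine ⟨(∑ i, ∑ j, N i j) + ∑ i, ∑ j, N' i j, fun i j => ?_⟩
  have hle : ∀ (N : Fin n → Fin n → ℕ) i j, N i j ≤ ∑ i, ∑ j, N i j := fun N i j =>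
    (Finset.single_le_sum (f := fun j => N i j) (fun _ _ => Nat.zero_le _)
      (Finset.mem_univ j)).trans
    (Finset.single_le_sum (f := fun i => ∑ j, N i j) (fun _ _ => Nat.zero_le _)
      (Finset.mem_univ i))
  simp only [Matrix.mul_apply]
  exact HasPoleExpansion.sum _ fun k _ =>
    ((hN i k).mono (hle N i k)).mul ((hN' k j).mono (hle N' k j))

/-! ### The difference equation of the functions `l_c^{(k)}` -/

theorem contDiff_character (x : ℂ) :
    ContDiff ℂ ⊤ fun c => character c x := by
  have h : Differentiable ℂ fun c => character c x := by
    simp only [character, div_eq_mul_inv]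
    exact (Complex.differentiable_one_div_Gamma.comp
      (differentiable_id.const_sub x)).const_mul _
  exact h.contDiff

theorem character_sub_one {x : ℂ} (hx : x ≠ 1)
    (c : ℂ) : character c (x - 1) = (1 - c / (x - 1)) * character c x := by
  have h₁ : x - 1 ≠ 0 := sub_ne_zero.2 hx
  have h₂ := Complex.Gamma_add_one (x - 1) h₁
  rw [sub_add_cancel] at h₂
  have h₃ := Complex.one_div_Gamma_eq_self_mul_one_div_Gamma_add_one (x - 1 - c)
  rw [show x - 1 - c + 1 = x - c by ring] at h₃
  rw [character, character, div_eq_mul_inv, div_eq_mul_inv, h₃, h₂]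
  field_simp

/-- The Leibniz rule has only two terms because the first factor is affine. -/
theorem iteratedDeriv_affine_mul {f : ℂ → ℂ} (hf : ContDiff ℂ ⊤ f)
    (a b : ℂ) (k : ℕ) :
    iteratedDeriv (k + 1) (fun c => (a + b * c) * f c) = fun c =>
      (a + b * c) * iteratedDeriv (k + 1) f c + (k + 1) * b * iteratedDeriv k f c := by
  have hd : ∀ k c, HasDerivAt (iteratedDeriv k f) (iteratedDeriv (k + 1) f c) c := fun k c => by
    rw [iteratedDeriv_succ]
    exact ((hf.differentiable_iteratedDeriv k (by exact WithTop.coe_lt_top _)) c).hasDerivAt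
  have ha : ∀ c, HasDerivAt (fun c => a + b * c) b c := fun c => by
    simpa using ((hasDerivAt_id c).const_mul b).const_add a
  induction k with
  | zero =>
    ext c
    have h₁ := (ha c).mul (hd 0 c)
    simp only [iteratedDeriv_zero] at h₁
    rw [iteratedDeriv_succ, iteratedDeriv_zero]
    refine h₁.deriv.trans ?_
    simp
    ring
  | succ k ih =>
    rw [iteratedDeriv_succ, ih]
    ext c
    have h₁ := ((ha c).mul (hd (k + 1) c)).add ((hd k c).const_mul (((k : ℂ) + 1) * b))
    refine h₁.deriv.trans ?_
    push_cast
    ring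

theorem logFun_zero (c x : ℂ) : logFun 0 c x = character c x := by
  simp [logFun]

/-- Differentiate `character_sub_one` k + 1 times in c; the Leibniz factor k + 1 is absorbed by the
factorial. -/
theorem logFun_succ_sub_one {x : ℂ} (hx : x ≠ 1)
    (k : ℕ) (c : ℂ) :
    logFun (k + 1) c (x - 1) =
      (1 - c / (x - 1)) * logFun (k + 1) c x - logFun k c x / (x - 1) := by
  have h₁ : (fun c => character c (x - 1)) =
      fun c => (1 + -(x - 1)⁻¹ * c) * character c x := by
    ext c
    rw [character_sub_one hx]
    ring
  rw [logFun, logFun, logFun, h₁, iteratedDeriv_affine_mul (contDiff_character x),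
    Nat.factorial_succ]
  have h₂ : (k.factorial : ℂ) ≠ 0 := by exact_mod_cast k.factorial_ne_zero
  have h₃ : (k : ℂ) + 1 ≠ 0 := by exact_mod_cast k.succ_ne_zero
  have h₄ : x - 1 ≠ 0 := sub_ne_zero.2 hx
  push_cast
  field_simp
  ring

theorem eventually_Gamma_sub_ne_zero (c : ℂ) :
    ∀ᶠ x in (cocountable : Filter ℂ), Complex.Gamma (x - c) ≠ 0 := by
  rw [Filter.Eventually, mem_cocountable]
  refine (Set.countable_range fun m : ℕ => c - (m : ℂ)).mono fun x hx => ?_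
  simp only [Set.mem_compl_iff, Set.mem_ofPred_eq, not_not, Complex.Gamma_eq_zero_iff] at hx
  obtain ⟨m, hm⟩ := hx
  exact ⟨m, by linear_combination -hm⟩

/-! ### Jordan data -/

namespace JordanData

variable {lt : ℂ → ℂ → Prop} {n : ℕ} (J J' : JordanData lt n)

/-- The position in `Fin n` of the `a`-th index of the `i`-th block. -/
def index : (Σ i, Fin (J.μ i)) ≃ Fin n := finSigmaFinEquiv.trans (finCongr J.sum_μ)

/-- The block containing an index. -/
def blk (p : Fin n) : Fin J.m := (J.index.symm p).1

/-- The position of an index in its block. -/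
def pos (p : Fin n) : ℕ := (J.index.symm p).2

/-- The eigenvalue attached to an index. -/
def eig (p : Fin n) : ℂ := J.c (J.blk p)

theorem pos_lt (p : Fin n) : J.pos p < J.μ (J.blk p) := (J.index.symm p).2.2

theorem blk_index (x : Σ i, Fin (J.μ i)) : J.blk (J.index x) = x.1 := by simp [blk]

theorem pos_index (x : Σ i, Fin (J.μ i)) : J.pos (J.index x) = x.2 := by
  rw [pos, Equiv.symm_apply_apply]

theorem exists_blk_pos {i : Fin J.m} {a : ℕ} (h : a < J.μ i) :
    ∃ p, J.blk p = i ∧ J.pos p = a :=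
  ⟨J.index ⟨i, a, h⟩, J.blk_index _, J.pos_index _⟩

theorem eq_of_blk_pos {p q : Fin n} (h₁ : J.blk p = J.blk q) (h₂ : J.pos p = J.pos q) :
    p = q := by
  obtain ⟨⟨i, a⟩, rfl⟩ := J.index.surjective p
  obtain ⟨⟨j, b⟩, rfl⟩ := J.index.surjective q
  simp only [blk_index, pos_index] at h₁ h₂
  subst h₁
  rw [Fin.ext h₂]

theorem pos_lt_size (p : Fin n) : J.pos p < n := by
  refine (J.pos_lt p).trans_le ?_
  conv_rhs => rw [← J.sum_μ]
  exact Finset.single_le_sum (f := J.μ) (fun _ _ => Nat.zero_le _) (Finset.mem_univ _)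

theorem logCar_apply (x : ℂ) (p q : Fin n) :
    J.logCar x p q = if J.blk p = J.blk q ∧ J.pos p ≤ J.pos q then
      logFun (J.pos q - J.pos p) (J.eig p) x else 0 := by
  obtain ⟨⟨i, a⟩, rfl⟩ := J.index.surjective p
  obtain ⟨⟨j, b⟩, rfl⟩ := J.index.surjective q
  have : J.logCar x (J.index ⟨i, a⟩) (J.index ⟨j, b⟩) =
      Matrix.blockDiagonal' (fun i => logCarBlock (J.c i) (J.μ i) x) ⟨i, a⟩ ⟨j, b⟩ := by
    simp [logCar, index]
  rw [this]
  simp only [blk_index, pos_index, eig]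
  by_cases hij : i = j
  · subst hij
    rw [Matrix.blockDiagonal'_apply_eq]
    simp [logCarBlock]
  · rw [Matrix.blockDiagonal'_apply_ne _ _ _ hij]
    simp [hij]

/-- The nilpotent part of the Jordan matrix. -/
def shift : Matrix (Fin n) (Fin n) ℂ :=
  Matrix.of fun p q => if J.blk p = J.blk q ∧ J.pos p + 1 = J.pos q then 1 else 0

/-- The Jordan matrix. -/
def jordan : Matrix (Fin n) (Fin n) ℂ := Matrix.diagonal J.eig + J.shift

theorem shift_apply_ne_zero {p q : Fin n} (h : J.shift p q ≠ 0) :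
    J.blk p = J.blk q ∧ J.pos p + 1 = J.pos q := by
  by_contra hc
  exact h (by simp [shift, hc])

theorem sum_shift_mul {p r : Fin n} (hb : J.blk p = J.blk r) (hp : J.pos p + 1 = J.pos r)
    (f : Fin n → ℂ) : ∑ q, J.shift p q * f q = f r := by
  rw [Finset.sum_eq_single r]
  · simp [shift, hb, hp]
  · intro q _ hq
    have : ¬(J.blk p = J.blk q ∧ J.pos p + 1 = J.pos q) := fun h =>
      hq (J.eq_of_blk_pos (h.1.symm.trans hb) (h.2.symm.trans hp))
    simp [shift, this]
  · simp

theorem sum_shift_mul_eq_zero {p : Fin n} {f : Fin n → ℂ}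
    (h : ∀ q, J.blk p = J.blk q → J.pos p + 1 = J.pos q → f q = 0) :
    ∑ q, J.shift p q * f q = 0 := by
  refine Finset.sum_eq_zero fun q _ => ?_
  by_cases hq : J.shift p q = 0
  · rw [hq, zero_mul]
  · obtain ⟨h₁, h₂⟩ := J.shift_apply_ne_zero hq
    rw [h q h₁ h₂, mul_zero]

theorem jordan_mul_apply (B : Matrix (Fin n) (Fin n) ℂ) (p q : Fin n) :
    (J.jordan * B) p q = J.eig p * B p q + ∑ r, J.shift p r * B r q := by
  rw [jordan, add_mul, Matrix.add_apply, Matrix.diagonal_mul, Matrix.mul_apply]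

theorem mul_jordan_apply (B : Matrix (Fin n) (Fin n) ℂ) (p q : Fin n) :
    (B * J.jordan) p q = B p q * J.eig q + ∑ r, B p r * J.shift r q := by
  rw [jordan, mul_add, Matrix.add_apply, Matrix.mul_diagonal, Matrix.mul_apply]

/-- A solution of the Sylvester equation `J B - B J' = z B` vanishes at the entries for which
`z` is not the difference of the eigenvalues. -/
theorem apply_eq_zero_of_sylvester {B : Matrix (Fin n) (Fin n) ℂ} {z : ℂ}
    (h : J.jordan * B - B * J'.jordan = z • B) (p q : Fin n) (hz : J.eig p - J'.eig q ≠ z) :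
    B p q = 0 := by
  -- In the (p, q) entry of the equation, the nilpotent parts bring in only the next row of the
  -- block of p and the preceding column of the block of q.
  induction hk : (n - J.pos p) + J'.pos q using Nat.strong_induction_on generalizing p q with
  | _ k ih =>
    have h₁ := congrFun (congrFun h p) q
    rw [Matrix.sub_apply, jordan_mul_apply, mul_jordan_apply, Matrix.smul_apply, smul_eq_mul,
      J.sum_shift_mul_eq_zero, Finset.sum_eq_zero] at h₁
    · have h₂ : (J.eig p - J'.eig q - z) * B p q = 0 := by linear_combination h₁
      exact (mul_eq_zero.1 h₂).resolve_left (sub_ne_zero.2 hz)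
    · intro r _
      by_cases hr : J'.shift r q = 0
      · rw [hr, mul_zero]
      · obtain ⟨hb, hp⟩ := J'.shift_apply_ne_zero hr
        rw [ih _ (by omega) p r (by rwa [eig, eig, hb]) rfl, zero_mul]
    · intro r hb hp
      have := J.pos_lt_size r
      exact ih _ (by omega) r q (by rwa [eig, ← hb]) rfl

/-- The kernel of `(J - c)ᵏ` consists of the vectors supported on the first `k` indices of each
block with eigenvalue `c`. -/
theorem pow_mulVec_eq_zero_iff (c : ℂ) (k : ℕ) (v : Fin n → ℂ) :
    ((J.jordan - Matrix.scalar (Fin n) c) ^ k).mulVec v = 0 ↔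
      ∀ p, ¬(J.eig p = c ∧ J.pos p < k) → v p = 0 := by
  induction k generalizing v with
  | zero => simp [funext_iff]
  | succ k ih =>
    have hv : ∀ p, (J.jordan - Matrix.scalar (Fin n) c).mulVec v p =
        (J.eig p - c) * v p + ∑ q, J.shift p q * v q := fun p => by
      rw [jordan, Matrix.sub_mulVec, Matrix.add_mulVec, Pi.sub_apply, Pi.add_apply,
        Matrix.mulVec_diagonal, Matrix.scalar_apply, Matrix.mulVec_diagonal, Matrix.mulVec,
        dotProduct]
      ring
    rw [pow_succ, ← Matrix.mulVec_mulVec, ih]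
    simp only [hv]
    constructor
    · intro h p hp
      by_cases hc : J.eig p = c
      · have hk : k + 1 ≤ J.pos p := by
          by_contra hlt
          exact hp ⟨hc, by omega⟩
        have := J.pos_lt p
        -- Let r be the predecessor of p in its block: row r of J - c only picks out v p.
        obtain ⟨r, hrb, hrp⟩ := J.exists_blk_pos (i := J.blk p) (a := J.pos p - 1) (by omega)
        have hr := h r (by omega)
        rwa [J.sum_shift_mul hrb (by omega), eig, hrb, ← eig, hc, sub_self, zero_mul,
          zero_add] at hr
      -- On a block with eigenvalue different from c, J - c is invertible: back substitution from
      -- the last index.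
      · induction hm : n - J.pos p using Nat.strong_induction_on generalizing p with
        | _ m ihm =>
          have h₁ := h p fun h => hc h.1
          rw [J.sum_shift_mul_eq_zero, add_zero] at h₁
          · exact (mul_eq_zero.1 h₁).resolve_left (sub_ne_zero.2 hc)
          · intro q hb hq
            have := J.pos_lt_size q
            have hcq : J.eig q ≠ c := by rwa [eig, ← hb]
            exact ihm _ (by omega) q (fun h => hcq h.1) hcq rfl
    · intro h p hp
      rw [J.sum_shift_mul_eq_zero, add_zero]
      · by_cases hc : J.eig p = c
        · rw [hc, sub_self, zero_mul]
        · rw [h p fun h => hc h.1, mul_zero]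
      · intro q hb hq
        refine h q fun hq' => hp ⟨?_, by omega⟩
        rw [eig, hb]
        exact hq'.1

/-- The kernel is a coordinate subspace by `pow_mulVec_eq_zero_iff`. -/
theorem finrank_ker_pow (c : ℂ) (k : ℕ) :
    Module.finrank ℂ (LinearMap.ker ((J.jordan - Matrix.scalar (Fin n) c) ^ k).mulVecLin) =
      Nat.card {p // J.eig p = c ∧ J.pos p < k} := by
  classical
  have hker : LinearMap.ker ((J.jordan - Matrix.scalar (Fin n) c) ^ k).mulVecLin =
      ⨅ i ∈ {p | J.eig p = c ∧ J.pos p < k}ᶜ,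
        LinearMap.ker (LinearMap.proj i : (Fin n → ℂ) →ₗ[ℂ] ℂ) := by
    ext v
    rw [LinearMap.mem_ker, Matrix.mulVecLin_apply, pow_mulVec_eq_zero_iff]
    simp
  rw [hker, (LinearMap.iInfKerProjEquiv ℂ (fun _ : Fin n => ℂ)
    (I := {p | J.eig p = c ∧ J.pos p < k}) disjoint_compl_right (by simp)).finrank_eq,
    Module.finrank_fintype_fun_eq_card, ← Nat.card_eq_fintype_card]
  rfl

/-- Conjugate matrices have conjugate powers, so the ranks agree, and with them the kernel
dimensions. -/
theorem card_eq_of_intertwine {R : Matrix (Fin n) (Fin n) ℂ} (hR : IsUnit R)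
    (h : J.jordan * R = R * J'.jordan) (c : ℂ) (k : ℕ) :
    Nat.card {p // J'.eig p = c ∧ J'.pos p < k} = Nat.card {p // J.eig p = c ∧ J.pos p < k} := by
  rw [← finrank_ker_pow, ← finrank_ker_pow]
  obtain ⟨u, rfl⟩ := hR
  set A := (J.jordan - Matrix.scalar (Fin n) c) ^ k
  set A' := (J'.jordan - Matrix.scalar (Fin n) c) ^ k
  have hA : A * u = u * A' := by
    have hs : SemiconjBy (u : Matrix (Fin n) (Fin n) ℂ) (J'.jordan - Matrix.scalar (Fin n) c)
        (J.jordan - Matrix.scalar (Fin n) c) := by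
      rw [SemiconjBy, mul_sub, sub_mul, h,
        (Matrix.scalar_commute c (fun _ => Commute.all _ _) (u : Matrix (Fin n) (Fin n) ℂ)).eq]
    exact (hs.pow_right k).symm
  have hA' : A = u * A' * (u⁻¹ : (Matrix (Fin n) (Fin n) ℂ)ˣ) := by
    rw [← hA, mul_assoc, Units.mul_inv, mul_one]
  have hr : A.rank = A'.rank := by
    rw [hA', Matrix.rank_mul_eq_left_of_isUnit_det _ _
      ((Matrix.isUnit_iff_isUnit_det _).1 (Units.isUnit _)),
      Matrix.rank_mul_eq_right_of_isUnit_det _ _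
      ((Matrix.isUnit_iff_isUnit_det _).1 (Units.isUnit _))]
  have h₁ := LinearMap.finrank_range_add_finrank_ker A.mulVecLin
  have h₂ := LinearMap.finrank_range_add_finrank_ker A'.mulVecLin
  rw [Matrix.rank, Matrix.rank] at hr
  omega

/-! ### Recovering the block sizes from the kernel dimensions. -/

/-- A block has an index in position k exactly when its size exceeds k, and then only one. -/
theorem card_pos_lt_succ (c : ℂ) (k : ℕ) :
    Nat.card {p // J.eig p = c ∧ J.pos p < k + 1} =
      Nat.card {p // J.eig p = c ∧ J.pos p < k} + Nat.card {i // J.c i = c ∧ k < J.μ i} := by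
  classical
  have h₁ : Nat.card {i // J.c i = c ∧ k < J.μ i} = Nat.card {p // J.eig p = c ∧ J.pos p = k} := by
    refine Nat.card_congr (Equiv.ofBijective
      (fun p : {p // J.eig p = c ∧ J.pos p = k} => (⟨J.blk p, p.2.1, p.2.2.symm.trans_lt (J.pos_lt p)⟩ :
        {i // J.c i = c ∧ k < J.μ i})) ⟨?_, ?_⟩).symm
    · rintro ⟨p, hp⟩ ⟨q, hq⟩ hpq
      simp only [Subtype.mk.injEq] at hpq ⊢
      exact J.eq_of_blk_pos hpq (hp.2.trans hq.2.symm)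
    · rintro ⟨i, hi⟩
      obtain ⟨p, rfl, hp⟩ := J.exists_blk_pos hi.2
      exact ⟨⟨p, hi.1, hp⟩, rfl⟩
  rw [h₁]
  simp only [Nat.card_eq_fintype_card, Fintype.card_subtype]
  rw [← Finset.card_union_of_disjoint]
  · congr 1
    ext p
    simp only [Finset.mem_filter, Finset.mem_univ, true_and, Finset.mem_union, ← and_or_left]
    rw [Nat.lt_succ_iff_lt_or_eq]
  · rw [Finset.disjoint_left]
    intro p hp hq
    simp only [Finset.mem_filter, Finset.mem_univ, true_and] at hp hq
    omega

theorem card_block_lt (c : ℂ) (k : ℕ) :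
    Nat.card {i // J.c i = c ∧ k < J.μ i} =
      Nat.card {i // J.c i = c ∧ k + 1 < J.μ i} + Nat.card {i // (J.c i, J.μ i) = (c, k + 1)} := by
  classical
  simp only [Nat.card_eq_fintype_card, Fintype.card_subtype]
  rw [← Finset.card_union_of_disjoint]
  · congr 1
    ext p
    simp only [Finset.mem_filter, Finset.mem_univ, true_and, Finset.mem_union, Prod.mk.injEq,
      ← and_or_left]
    exact and_congr_right fun _ => by omega
  · rw [Finset.disjoint_left]
    intro p hp hq
    simp only [Finset.mem_filter, Finset.mem_univ, true_and, Prod.mk.injEq] at hp hq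
    omega

/-- The list of blocks. -/
def blocks : List (ℂ × ℕ) := List.ofFn fun i => (J.c i, J.μ i)

theorem eq_of_blocks_eq (h : J.blocks = J'.blocks) : J = J' := by
  have h₁ := List.ofFn_inj'.1 h
  obtain ⟨m, c, μ, h1, h2, h3, h4⟩ := J
  obtain ⟨m', c', μ', h1', h2', h3', h4'⟩ := J'
  simp only [Sigma.mk.injEq] at h₁
  obtain ⟨rfl, h₂⟩ := h₁
  have h₂ := eq_of_heq h₂
  have hc : c = c' := funext fun i => congrArg Prod.fst (congrFun h₂ i)
  have hμ : μ = μ' := funext fun i => congrArg Prod.snd (congrFun h₂ i)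
  subst hc hμ
  rfl

theorem count_blocks [DecidableEq (ℂ × ℕ)] (y : ℂ × ℕ) :
    J.blocks.count y = Nat.card {i // (J.c i, J.μ i) = y} := by
  rw [blocks, List.ofFn_eq_map, List.count, List.countP_map, List.countP_eq_length_filter,
    Nat.card_eq_fintype_card, Fintype.card_subtype, Fin.univ_def]
  simp [Finset.card, Finset.filter, Function.comp_def, beq_eq_decide]

/-- Jordan data in normal form are determined by the similarity class of the Jordan matrix. -/
theorem eq_of_intertwine [IsStrictTotalOrder ℂ lt] {R : Matrix (Fin n) (Fin n) ℂ}
    (hR : IsUnit R) (h : J.jordan * R = R * J'.jordan) : J = J' := by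
  classical
  have hk : ∀ c k, Nat.card {i // J.c i = c ∧ k < J.μ i} =
      Nat.card {i // J'.c i = c ∧ k < J'.μ i} := fun c k => by
    have h₁ := J.card_eq_of_intertwine J' hR h c k
    have h₂ := J.card_eq_of_intertwine J' hR h c (k + 1)
    rw [card_pos_lt_succ, card_pos_lt_succ] at h₂
    omega
  -- Two lists sorted for the same antisymmetric relation are equal as soon as they are permutations
  -- of each other.
  refine J.eq_of_blocks_eq J' (List.Perm.eq_of_pairwise
    (le := fun y z => lt y.1 z.1 ∨ (y.1 = z.1 ∧ y.2 ≤ z.2)) ?_ ?_ ?_ ?_)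
  · rintro ⟨c, k⟩ ⟨c', k'⟩ - - (h₁ | ⟨h₁, h₁'⟩) (h₂ | ⟨h₂, h₂'⟩)
    · exact absurd h₂ (asymm h₁)
    · exact absurd (h₂ ▸ h₁) (irrefl _)
    · exact absurd (h₁ ▸ h₂) (irrefl _)
    · exact Prod.ext h₁ (le_antisymm h₁' h₂')
  · exact List.pairwise_ofFn.2 fun i j hij => J.sorted i j hij
  · exact List.pairwise_ofFn.2 fun i j hij => J'.sorted i j hij
  · rw [List.perm_iff_count]
    rintro ⟨c, k⟩
    rw [count_blocks, count_blocks]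
    rcases k with _ | k
    -- The kernel dimensions do not see blocks of size 0; `μ_pos` excludes them.
    · have hz : ∀ K : JordanData lt n, Nat.card {i // (K.c i, K.μ i) = (c, 0)} = 0 := fun K => by
        rw [Nat.card_eq_zero]
        refine Or.inl ⟨fun i => ?_⟩
        have := K.μ_pos i
        have := congrArg Prod.snd i.2
        simp only at this
        omega
      rw [hz, hz]
    · have h₁ := hk c k
      rw [J.card_block_lt, J'.card_block_lt, hk c (k + 1)] at h₁
      omega

/-! ### The commutant of the Jordan matrix. -/

theorem shift_pow_apply (k : ℕ) (p q : Fin n) :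
    (J.shift ^ k) p q = if J.blk p = J.blk q ∧ J.pos p + k = J.pos q then 1 else 0 := by
  induction k generalizing p with
  | zero =>
    rw [pow_zero, Matrix.one_apply]
    refine if_congr ⟨fun h => by simp [h], fun h => J.eq_of_blk_pos h.1 h.2⟩ rfl rfl
  | succ k ih =>
    rw [pow_succ', Matrix.mul_apply]
    split_ifs with h
    · have := J.pos_lt q
      obtain ⟨r, hrb, hrp⟩ := J.exists_blk_pos (i := J.blk q) (a := J.pos p + 1) (by omega)
      rw [J.sum_shift_mul (h.1.trans hrb.symm) hrp.symm fun r => (J.shift ^ k) r q, ih,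
        if_pos ⟨hrb, by omega⟩]
    · refine J.sum_shift_mul_eq_zero fun r hb hp => ?_
      rw [ih, if_neg fun hr => h ⟨hb.trans hr.1, by omega⟩]

/-- This form displays the log-car matrix as built from functions of the eigenvalue part and powers
of the nilpotent part, which reduces commutation to these two. -/
theorem logCar_eq_sum (x : ℂ) :
    J.logCar x = ∑ k ∈ Finset.range n,
      Matrix.diagonal (fun p => logFun k (J.eig p) x) * J.shift ^ k := by
  ext p q
  simp only [Matrix.sum_apply, Matrix.diagonal_mul, shift_pow_apply, logCar_apply]
  split_ifs with h
  · have := J.pos_lt_size q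
    rw [Finset.sum_eq_single (J.pos q - J.pos p)]
    · rw [if_pos ⟨h.1, by omega⟩, mul_one]
    · intro k _ hk
      rw [if_neg (by omega), mul_zero]
    · intro hk
      exact absurd (Finset.mem_range.2 (by omega)) hk
  · refine (Finset.sum_eq_zero fun k _ => ?_).symm
    rw [if_neg fun hk => h ⟨hk.1, by omega⟩, mul_zero]

/-- A matrix commuting with J has no entries between distinct eigenvalues: the Sylvester equation
with z = 0. -/
theorem commute_diagonal_of_commute_jordan {R : Matrix (Fin n) (Fin n) ℂ}
    (h : Commute J.jordan R) (f : ℂ → ℂ) : Commute (Matrix.diagonal fun p => f (J.eig p)) R := by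
  ext p q
  rw [Matrix.diagonal_mul, Matrix.mul_diagonal]
  by_cases hpq : J.eig p = J.eig q
  · rw [hpq, mul_comm]
  · rw [J.apply_eq_zero_of_sylvester J (B := R) (z := 0) (by rw [h.eq]; simp) p q
      (sub_ne_zero.2 hpq), mul_zero, zero_mul]

theorem commute_logCar {R : Matrix (Fin n) (Fin n) ℂ} (h : Commute J.jordan R) (x : ℂ) :
    Commute (J.logCar x) R := by
  have hS : Commute J.shift R := by
    have := h.sub_left (J.commute_diagonal_of_commute_jordan h id)
    simpa [jordan] using this
  rw [logCar_eq_sum]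
  exact Commute.sum_left _ _ _ fun k _ =>
    (J.commute_diagonal_of_commute_jordan h fun c => logFun k c x).mul_left (hS.pow_left k)

/-! ### The difference equation of a log-car matrix -/

/-- The inhomogeneous term of `logFun_succ_sub_one` is exactly the action of the nilpotent part; on
the diagonal only the character equation remains. -/
theorem logCar_sub_one {x : ℂ} (hx : x ≠ 1) :
    (x - 1) • J.logCar (x - 1) = ((x - 1) • 1 - J.jordan) * J.logCar x := by
  have h₁ : x - 1 ≠ 0 := sub_ne_zero.2 hx
  ext p q
  rw [sub_mul, Matrix.sub_apply, smul_one_mul, Matrix.smul_apply, Matrix.smul_apply,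
    jordan_mul_apply, smul_eq_mul, smul_eq_mul]
  by_cases h : J.blk p = J.blk q ∧ J.pos p < J.pos q
  · have := J.pos_lt q
    obtain ⟨r, hrb, hrp⟩ := J.exists_blk_pos (i := J.blk q) (a := J.pos p + 1) (by omega)
    rw [J.sum_shift_mul (h.1.trans hrb.symm) hrp.symm fun r => J.logCar x r q, logCar_apply,
      logCar_apply, logCar_apply, if_pos ⟨h.1, h.2.le⟩, if_pos ⟨h.1, h.2.le⟩,
      if_pos ⟨hrb, by omega⟩, hrp,
      show J.pos q - J.pos p = (J.pos q - (J.pos p + 1)) + 1 by omega,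
      logFun_succ_sub_one hx, eig, eig, hrb, h.1]
    field_simp
    ring
  · rw [J.sum_shift_mul_eq_zero, add_zero, logCar_apply, logCar_apply]
    · split_ifs with h₂
      · rw [show J.pos q - J.pos p = 0 by omega, logFun_zero, logFun_zero,
          character_sub_one hx]
        field_simp
      · simp
    · intro r hb hp
      rw [logCar_apply, if_neg fun hr => h ⟨hb.trans hr.1, by omega⟩]

theorem isUnit_logCar {x : ℂ} (hx : ∀ p, character (J.eig p) x ≠ 0) : IsUnit (J.logCar x) := by
  rw [Matrix.isUnit_iff_isUnit_det, isUnit_iff_ne_zero]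
  intro h0
  obtain ⟨v, hv, hNv⟩ := Matrix.exists_mulVec_eq_zero_iff.2 h0
  refine hv (funext fun p => ?_)
  rw [Pi.zero_apply]
  induction hm : n - J.pos p using Nat.strong_induction_on generalizing p with
  | _ m ih =>
    have h₁ := congrFun hNv p
    rw [Matrix.mulVec, dotProduct, Finset.sum_eq_single p] at h₁
    · rw [logCar_apply, if_pos ⟨rfl, le_rfl⟩, Nat.sub_self, logFun_zero, Pi.zero_apply] at h₁
      exact (mul_eq_zero.1 h₁).resolve_left (hx p)
    · intro q _ hqp
      rw [logCar_apply]
      split_ifs with h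
      · have : J.pos p ≠ J.pos q := fun he => hqp (J.eq_of_blk_pos h.1 he).symm
        have := J.pos_lt_size q
        rw [ih _ (by omega) q rfl, mul_zero]
      · rw [zero_mul]
    · simp

theorem eventually_logCar :
    ∀ᶠ x in (cocountable : Filter ℂ), IsUnit (J.logCar x) ∧
      (x - 1) • J.logCar (x - 1) = ((x - 1) • 1 - J.jordan) * J.logCar x := by
  have h₀ := eventually_Gamma_sub_ne_zero 0
  simp only [sub_zero] at h₀
  filter_upwards [h₀, eventually_all.2 fun p => eventually_Gamma_sub_ne_zero (J.eig p),
    eventually_cocountable_ne 1] with x h₁ h₂ h₃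
  exact ⟨J.isUnit_logCar fun p => div_ne_zero h₁ (h₂ p), J.logCar_sub_one h₃⟩

end JordanData

open scoped Matrix.Norms.Operator

/-! ### More on the filter `rightInfinity` -/

theorem eventually_cocountable_of_rightInfinity {p : ℂ → Prop} (h : ∀ᶠ x in rightInfinity, p x) :
    ∃ r : ℝ, ∀ᶠ x in (cocountable : Filter ℂ), r < x.re → p x := by
  obtain ⟨s, ⟨u, hu, hus⟩, t, ht, hst⟩ := mem_inf_iff_superset.1 h
  obtain ⟨r, hr⟩ := mem_atTop_sets.1 hu
  exact ⟨r, mem_of_superset ht fun x hx hxr => hst ⟨hus (hr _ hxr.le), hx⟩⟩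

instance : CountableInterFilter (cocountable : Filter ℂ) :=
  CardinalInterFilter.toCountableInterFilter _ Cardinal.aleph0_lt_aleph_one

theorem eventually_cocountable_add_nat {p : ℂ → Prop} (h : ∀ᶠ x in cocountable, p x) :
    ∀ᶠ x in (cocountable : Filter ℂ), ∀ m : ℕ, p (x + m) := by
  rw [eventually_countable_forall]
  intro m
  simpa using eventually_cocountable_sub h (-(m : ℂ))

/-- A countable basis of l and the countably many translations leave only a countable exceptional
set of starting points. -/
theorem eventually_tendsto_add_nat {α : Type*} {f : ℂ → α} {l : Filter α} [l.IsCountablyGenerated]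
    (h : Tendsto f rightInfinity l) :
    ∀ᶠ x in (cocountable : Filter ℂ), Tendsto (fun m : ℕ => f (x + m)) atTop l := by
  obtain ⟨s, hs⟩ := l.exists_antitone_basis
  choose r hr using fun i => eventually_cocountable_of_rightInfinity (h (hs.1.mem_of_mem (i := i) trivial))
  filter_upwards [eventually_countable_forall.2 fun i => eventually_cocountable_add_nat (hr i)]
    with x hx
  rw [hs.1.tendsto_right_iff]
  intro i _
  have : Tendsto (fun m : ℕ => x.re + (m : ℝ)) atTop atTop :=
    tendsto_atTop_add_const_left _ _ tendsto_natCast_atTop_atTop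
  filter_upwards [this.eventually_gt_atTop (r i)] with m hm
  exact hx i m (by simpa using hm)

theorem eventually_isUnit_smul_one_sub {n : ℕ} (A : Matrix (Fin n) (Fin n) ℂ) :
    ∀ᶠ x in (cocountable : Filter ℂ), IsUnit (x • 1 - A) := by
  rw [Filter.Eventually, mem_cocountable]
  refine (A.charpoly.roots.toFinset.countable_toSet).mono fun x hx => ?_
  rw [Set.mem_compl_iff, Set.mem_ofPred_eq, Matrix.isUnit_iff_isUnit_det, isUnit_iff_ne_zero,
    not_not, Matrix.smul_one_eq_diagonal, ← Matrix.scalar_apply, ← Matrix.eval_charpoly] at hx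
  simpa [A.charpoly_monic.ne_zero] using hx

/-- Near any point a meromorphic function either vanishes or has no zero, off that point; the second
is impossible because a cocountable set is dense. -/
theorem _root_.Meromorphic.eventually_codiscrete_eq_zero {f : ℂ → ℂ} (hf : Meromorphic f)
    (h : ∀ᶠ x in cocountable, f x = 0) : ∀ᶠ x in codiscrete ℂ, f x = 0 := by
  change {x | f x = 0} ∈ codiscreteWithin Set.univ
  rw [mem_codiscreteWithin_iff_forall_mem_nhdsNE]
  intro x _
  simp only [Set.compl_univ, Set.union_empty]
  refine (hf x).eventually_eq_zero_or_eventually_ne_zero.resolve_right fun hne => ?_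
  obtain ⟨u, hu, hxu, hus⟩ := eventually_nhds_iff.1 (eventually_nhdsWithin_iff.1 hne) |>.imp
    fun u hu => (⟨hu.2.1, hu.2.2, hu.1⟩ : IsOpen u ∧ x ∈ u ∧ ∀ y ∈ u, y ∈ ({x}ᶜ : Set ℂ) → f y ≠ 0)
  have hc : ({y | f y = 0 ∧ y ≠ x}ᶜ).Countable :=
    mem_cocountable.1 (h.and (eventually_cocountable_ne x))
  have hd := hc.dense_compl ℂ
  rw [compl_compl] at hd
  obtain ⟨y, hy, hy'⟩ := hd.inter_open_nonempty u hu ⟨x, hxu⟩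
  exact hus y hy hy'.2 hy'.1

/-! ### Matrices intertwining two Fuchsian systems with constant coefficients -/

/-- `Q` is a gauge transformation between the systems with constant matrices `A'` and `A`. -/
def Intertwines {n : ℕ} (A A' : Matrix (Fin n) (Fin n) ℂ) (Q : ℂ → Matrix (Fin n) (Fin n) ℂ)
    (x : ℂ) : Prop :=
  Q (x - 1) * ((x - 1) • 1 - A') = ((x - 1) • 1 - A) * Q x

variable {n : ℕ} {A A' : Matrix (Fin n) (Fin n) ℂ} {Q : ℂ → Matrix (Fin n) (Fin n) ℂ}

theorem Intertwines.sub_const {x : ℂ} (h : Intertwines A A' Q x)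
    {C : Matrix (Fin n) (Fin n) ℂ} (hC : A * C = C * A') :
    Intertwines A A' (fun x => Q x - C) x := by
  rw [Intertwines] at h ⊢
  rw [sub_mul, h, mul_sub, mul_sub, sub_mul, sub_mul, hC]
  simp

/-- This is the derivative of t^j at t = 1, taken along t = 1 - x⁻¹. -/
theorem tendsto_mul_one_sub_zpow (j : ℤ) :
    Tendsto (fun x : ℂ => (x - 1) * (1 - (1 - x⁻¹) ^ j)) rightInfinity (𝓝 j) := by
  have h₁ : HasDerivAt (fun t : ℂ => t ^ j) j 1 := by
    simpa using hasDerivAt_zpow j (1 : ℂ) (Or.inl one_ne_zero)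
  have h₂ : Tendsto (fun x : ℂ => -x⁻¹) rightInfinity (𝓝[≠] 0) := by
    refine tendsto_nhdsWithin_iff.2 ⟨by simpa using tendsto_inv_rightInfinity.neg, ?_⟩
    filter_upwards [eventually_ne_rightInfinity 0] with x hx
    simpa using hx
  have h₃ := h₁.tendsto_slope_zero.comp h₂
  have h₄ := (tendsto_inv_rightInfinity.const_sub 1).mul h₃
  simp only [sub_zero, one_mul] at h₄
  refine h₄.congr' ?_
  filter_upwards [eventually_ne_rightInfinity 0] with x hx
  simp only [Function.comp_apply, one_zpow, smul_eq_mul, ← sub_eq_add_neg]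
  field_simp
  ring

/-- The leading coefficient `B₀` of an intertwining matrix `Q ∼ xʲ (B₀ + B₁ x⁻¹ + ⋯)` satisfies
`A B₀ - B₀ A' = j B₀`. -/
theorem sylvester_of_tendsto (h : ∀ᶠ x in rightInfinity, Intertwines A A' Q x) {j : ℤ}
    {B₀ B₁ : Matrix (Fin n) (Fin n) ℂ}
    (hB : Tendsto (fun x : ℂ => x • (x ^ (-j) • Q x - B₀)) rightInfinity (𝓝 B₁)) :
    A * B₀ - B₀ * A' = (j : ℂ) • B₀ := by
  set u : ℂ → Matrix (Fin n) (Fin n) ℂ := fun x => x ^ (-j) • Q x with hu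
  have hu₀ : Tendsto u rightInfinity (𝓝 B₀) := by
    have h₁ := (tendsto_inv_rightInfinity.smul hB).add_const B₀
    rw [zero_smul, zero_add] at h₁
    refine h₁.congr' ?_
    filter_upwards [eventually_ne_rightInfinity 0] with x hx
    rw [inv_smul_smul₀ hx, sub_add_cancel]
  have hu₁ := hu₀.comp tendsto_sub_one_rightInfinity
  have hB₁ := hB.comp tendsto_sub_one_rightInfinity
  have h1x : Tendsto (fun x : ℂ => 1 - x⁻¹) rightInfinity (𝓝 1) := by
    simpa using tendsto_inv_rightInfinity.const_sub 1
  have hz : Tendsto (fun x : ℂ => (1 - x⁻¹) ^ j) rightInfinity (𝓝 1) := by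
    simpa using h1x.zpow₀ j (Or.inl one_ne_zero)
  -- With u = x⁻ʲ Q, the quantity (x - 1)(u(x) - (1 - x⁻¹)^j u(x - 1)) splits into (x - 1)(u(x) -
  -- u(x - 1)), which tends to B₁ - B₁ = 0, and (x - 1)(1 - (1 - x⁻¹)^j) u(x - 1), which tends to j
  -- B₀.
  have hl := ((h1x.smul hB).sub hB₁).add ((tendsto_mul_one_sub_zpow j).smul hu₁)
  have hr := (hu₀.const_mul A).sub ((hz.smul hu₁).mul_const A')
  simp only [one_smul, sub_self, zero_add] at hl hr
  refine tendsto_nhds_unique (hr.congr' ?_) hl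
  filter_upwards [h, eventually_ne_rightInfinity 0, eventually_ne_rightInfinity 1] with x hx h0 h1
  have h1' : x - 1 ≠ 0 := sub_ne_zero.2 h1
  have h₁ : (1 - x⁻¹) ^ j • u (x - 1) = x ^ (-j) • Q (x - 1) := by
    rw [hu]
    simp only [smul_smul]
    congr 1
    rw [show 1 - x⁻¹ = (x - 1) * x⁻¹ by field_simp, mul_zpow, inv_zpow, zpow_neg, zpow_neg]
    field_simp
  have h₂ : (x - 1) • (Q x - Q (x - 1)) = A * Q x - Q (x - 1) * A' := by
    rw [Intertwines, mul_sub, sub_mul, smul_one_mul, mul_smul_one] at hx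
    rw [smul_sub, sub_eq_sub_iff_add_eq_add]
    rw [sub_eq_sub_iff_add_eq_add] at hx
    rw [add_comm (A * Q x), hx]
  have h₃ : A * u x - (1 - x⁻¹) ^ j • u (x - 1) * A' =
      (x - 1) • (u x - (1 - x⁻¹) ^ j • u (x - 1)) := by
    rw [h₁, hu]
    simp only
    rw [mul_smul_comm, smul_mul_assoc, ← smul_sub, ← h₂, ← smul_sub, smul_comm]
  simp only [Function.comp_apply]
  rw [h₃, smul_smul (1 - x⁻¹), show (1 - x⁻¹) * x = x - 1 by field_simp]
  simp only [hu]
  module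

/-- The matrix of `k`-th coefficients of a matrix of power series. -/
def coeffMatrix (q : Fin n → Fin n → PowerSeries ℂ) (k : ℕ) : Matrix (Fin n) (Fin n) ℂ :=
  Matrix.of fun a b => PowerSeries.coeff k (q a b)

/-- The first possibly nonzero coefficient sits at x^(N - k), so `sylvester_of_tendsto` applies with
j = N - k. -/
theorem sylvester_coeffMatrix (h : ∀ᶠ x in rightInfinity, Intertwines A A' Q x) {N k : ℕ}
    {q : Fin n → Fin n → PowerSeries ℂ}
    (hq : ∀ a b, HasExpansion (fun x => x⁻¹ ^ N * Q x a b) (q a b))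
    (hk : ∀ m < k, coeffMatrix q m = 0) :
    A * coeffMatrix q k - coeffMatrix q k * A' =
      (((N : ℤ) - k : ℤ) : ℂ) • coeffMatrix q k := by
  have hdvd : ∀ a b, ∃ u, q a b = PowerSeries.X ^ k * u := fun a b =>
    PowerSeries.X_pow_dvd_iff.2 fun m hm => congrFun (congrFun (hk m hm) a) b
  choose u hu using hdvd
  have hu₀ : ∀ a b, PowerSeries.constantCoeff (u a b) = coeffMatrix q k a b := fun a b => by
    have := PowerSeries.coeff_X_pow_mul (u a b) k 0
    rw [zero_add, ← hu, PowerSeries.coeff_zero_eq_constantCoeff_apply] at this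
    exact this.symm
  have hv : ∀ a b, ∃ v, u a b - PowerSeries.C (coeffMatrix q k a b) = PowerSeries.X ^ 1 * v :=
    fun a b => by
      have : PowerSeries.X ∣ u a b - PowerSeries.C (coeffMatrix q k a b) := by
        rw [PowerSeries.X_dvd_iff, map_sub, hu₀, PowerSeries.constantCoeff_C, sub_self]
      simpa [Dvd.dvd] using this
  choose v hv using hv
  refine sylvester_of_tendsto h
    (B₁ := Matrix.of fun a b => PowerSeries.constantCoeff (v a b)) ?_
  refine tendsto_pi_nhds.2 fun a => tendsto_pi_nhds.2 fun b => ?_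
  have h₁ := hq a b
  rw [hu] at h₁
  have h₂ := h₁.mul_pow_of_X_pow_mul.add (HasExpansion.const (-coeffMatrix q k a b))
  rw [map_neg, ← sub_eq_add_neg, hv] at h₂
  refine h₂.mul_pow_of_X_pow_mul.tendsto.congr' ?_
  filter_upwards [eventually_ne_rightInfinity 0] with x hx
  simp only [Matrix.smul_apply, Matrix.sub_apply, smul_eq_mul, pow_one]
  rw [neg_sub, zpow_sub₀ hx, zpow_natCast, zpow_natCast, inv_pow]
  ring

/-- If no nonzero integer is a difference of eigenvalues of `A` and `A'`, an intertwining matrix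
with Laurent expansion in `x⁻¹` is constant up to a flat matrix. -/
theorem exists_hasExpansion_zero (h : ∀ᶠ x in rightInfinity, Intertwines A A' Q x)
    (hA : ∀ (z : ℤ) (B : Matrix (Fin n) (Fin n) ℂ), z ≠ 0 → A * B - B * A' = (z : ℂ) • B → B = 0)
    {N : ℕ} (hQ : ∀ a b, HasPoleExpansion N fun x => Q x a b) :
    ∃ C : Matrix (Fin n) (Fin n) ℂ, A * C = C * A' ∧
      ∀ a b, HasExpansion (fun x => x⁻¹ ^ N * (Q x - C) a b) 0 := by
  choose q hq using hQ
  have hsub : ∀ (D : Matrix (Fin n) (Fin n) ℂ) a b,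
      HasExpansion (fun x => x⁻¹ ^ N * (Q x - D) a b)
        (q a b - PowerSeries.C (D a b) * PowerSeries.X ^ N) := fun D a b => by
    have := (hq a b).add ((HasExpansion.const (-D a b)).mul (HasExpansion.inv_pow N))
    rw [map_neg, neg_mul, ← sub_eq_add_neg] at this
    refine this.congr (.of_eq ?_)
    ext x
    rw [Matrix.sub_apply]
    ring
  have hcoeff : ∀ (D : Matrix (Fin n) (Fin n) ℂ) m,
      coeffMatrix (fun a b => q a b - PowerSeries.C (D a b) * PowerSeries.X ^ N) m =
        coeffMatrix q m - if m = N then D else 0 := fun D m => by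
    ext a b
    simp only [coeffMatrix, Matrix.of_apply, map_sub, PowerSeries.coeff_C_mul,
      PowerSeries.coeff_X_pow, Matrix.sub_apply]
    split_ifs <;> simp
  have key : ∀ k, (k ≠ N → coeffMatrix q k = 0) ∧
      (k = N → A * coeffMatrix q k = coeffMatrix q k * A') := by
    intro k
    induction k using Nat.strong_induction_on with
    | _ k ih =>
      -- Index N is the constant term of Q, the only one allowed to survive. Beyond it, this term is
      -- subtracted so that all coefficients below k vanish.
      set D := if N < k then coeffMatrix q N else 0 with hD
      have hAD : A * D = D * A' := by
        rw [hD]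
        split_ifs with hN
        · exact (ih N hN).2 rfl
        · simp
      have h₁ := sylvester_coeffMatrix (h.mono fun x hx => hx.sub_const hAD) (k := k) (hsub D)
        fun m hm => by
          rw [hcoeff]
          split_ifs with hmN
          · subst hmN
            rw [hD, if_pos hm, sub_self]
          · rw [(ih m hm).1 hmN, sub_zero]
      have h₂ : coeffMatrix q k - (if k = N then D else 0) = coeffMatrix q k := by
        split_ifs with hkN
        · rw [hD, if_neg (by omega), sub_zero]
        · rw [sub_zero]
      rw [hcoeff, h₂] at h₁
      refine ⟨fun hkN => hA _ _ (by omega) h₁, fun hkN => ?_⟩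
      subst hkN
      simpa [sub_eq_zero] using h₁
  refine ⟨coeffMatrix q N, (key N).2 rfl, fun a b => ?_⟩
  have h₀ : q a b - PowerSeries.C (coeffMatrix q N a b) * PowerSeries.X ^ N = 0 := by
    ext m
    have h₁ := congrFun (congrFun (hcoeff (coeffMatrix q N) m) a) b
    refine h₁.trans ?_
    by_cases hm : m = N
    · subst hm
      simp
    · simp [hm, (key m).1 hm]
  simpa only [h₀] using hsub (coeffMatrix q N) a b

/-- The equation gives (|x| - a) ‖Q(x)‖ ≤ (|x| + a) ‖Q(x + 1)‖. With t = Re x, the ratio of the two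
factors is at most 1 + m/t, hence at most (1 + 1/t)^m by Bernoulli. -/
theorem Intertwines.norm_mul_re_pow_le {a : ℝ} (ha : 0 ≤ a) (hA : ‖A‖ ≤ a) (hA' : ‖A'‖ ≤ a) {m : ℕ}
    (hm : 4 * a ≤ m) {x : ℂ} (h : Intertwines A A' Q (x + 1)) (hx : 2 * a < x.re) :
    ‖Q x‖ * x.re ^ m ≤ ‖Q (x + 1)‖ * (x + 1).re ^ m := by
  have h₁ : x • Q x = Q x * A' + x • Q (x + 1) - A * Q (x + 1) := by
    rw [Intertwines, add_sub_cancel_right, mul_sub, sub_mul, smul_one_mul, mul_smul_one] at h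
    rw [add_sub_assoc, ← h, add_sub_cancel]
  have h₂ : ‖x‖ * ‖Q x‖ ≤ ‖Q x‖ * a + ‖x‖ * ‖Q (x + 1)‖ + a * ‖Q (x + 1)‖ := by
    rw [← norm_smul, h₁, ← norm_smul]
    refine (norm_sub_le _ _).trans (add_le_add ((norm_add_le _ _).trans (add_le_add ?_ le_rfl)) ?_)
    · exact (norm_mul_le _ _).trans (mul_le_mul_of_nonneg_left hA' (norm_nonneg _))
    · exact (norm_mul_le _ _).trans (mul_le_mul_of_nonneg_right hA (norm_nonneg _))
  set t := x.re with ht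
  have hxt : t ≤ ‖x‖ := Complex.re_le_norm x
  have ht0 : 0 < t := by linarith
  have hb : 1 + (m : ℝ) * t⁻¹ ≤ (1 + t⁻¹) ^ m :=
    one_add_mul_le_pow (by have := inv_pos.2 ht0; linarith) m
  have hpow : (x + 1).re ^ m = t ^ m * (1 + t⁻¹) ^ m := by
    rw [← mul_pow, Complex.add_re, Complex.one_re, ← ht]
    congr 1
    field_simp
  have h₃ : ‖Q x‖ ≤ ‖Q (x + 1)‖ * (1 + m * t⁻¹) := by
    have hpos : 0 < ‖x‖ - a := by linarith
    have h₄ : (‖x‖ + a) ≤ (‖x‖ - a) * (1 + m * t⁻¹) := by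
      -- Since t > 2a, |x| - a ≥ t/2; this is where m ≥ 4a comes from.
      have h₅ : 2 * a ≤ (‖x‖ - a) * (m * t⁻¹) := by
        have h₆ : t / 2 * (4 * a * t⁻¹) ≤ (‖x‖ - a) * (m * t⁻¹) :=
          mul_le_mul (by linarith) (mul_le_mul_of_nonneg_right hm (by positivity))
            (by positivity) hpos.le
        have h₇ : t / 2 * (4 * a * t⁻¹) = 2 * a := by
          field_simp
          ring
        linarith
      linarith
    have h₅ : (‖x‖ - a) * ‖Q x‖ ≤ (‖x‖ - a) * (‖Q (x + 1)‖ * (1 + m * t⁻¹)) := by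
      have := mul_le_mul_of_nonneg_left h₄ (norm_nonneg (Q (x + 1)))
      linarith
    exact le_of_mul_le_mul_left h₅ hpos
  calc ‖Q x‖ * t ^ m ≤ ‖Q (x + 1)‖ * (1 + t⁻¹) ^ m * t ^ m :=
        mul_le_mul_of_nonneg_right
          (h₃.trans (mul_le_mul_of_nonneg_left hb (norm_nonneg _))) (by positivity)
    _ = _ := by rw [hpow]; ring

theorem tendsto_pow_smul_of_hasExpansion_zero {N : ℕ}
    (hQ : ∀ a b, HasExpansion (fun x => x⁻¹ ^ N * Q x a b) 0) (m : ℕ) :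
    Tendsto (fun x : ℂ => x ^ m • Q x) rightInfinity (𝓝 0) := by
  refine tendsto_pi_nhds.2 fun a => tendsto_pi_nhds.2 fun b => ?_
  have h₁ := hQ a b
  rw [← mul_zero (PowerSeries.X ^ (m + N))] at h₁
  have h₂ := h₁.mul_pow_of_X_pow_mul.tendsto
  rw [map_zero] at h₂
  refine h₂.congr' ?_
  filter_upwards [eventually_ne_rightInfinity 0] with x hx
  rw [Matrix.smul_apply, smul_eq_mul, pow_add, inv_pow]
  field_simp

/-- A flat intertwining matrix is zero. -/
theorem eventually_eq_zero_of_hasExpansion_zero (h : ∀ᶠ x in cocountable, Intertwines A A' Q x)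
    {N : ℕ} (hQ : ∀ a b, HasExpansion (fun x => x⁻¹ ^ N * Q x a b) 0) :
    ∀ᶠ x in cocountable, Q x = 0 := by
  set a := max ‖A‖ ‖A'‖
  have ha : 0 ≤ a := (norm_nonneg A).trans (le_max_left _ _)
  obtain ⟨m, hm⟩ := exists_nat_ge (4 * a)
  have ht : Tendsto (fun x : ℂ => ‖Q x‖ * x.re ^ m) rightInfinity (𝓝 0) := by
    have h₁ := (tendsto_pow_smul_of_hasExpansion_zero hQ m).norm
    rw [norm_zero] at h₁
    refine squeeze_zero' ?_ ?_ h₁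
    · filter_upwards [eventually_re_gt 0] with x hx
      positivity
    · filter_upwards [eventually_re_gt 0] with x hx
      rw [norm_smul, norm_pow, mul_comm]
      exact mul_le_mul_of_nonneg_right (pow_le_pow_left₀ hx.le (Complex.re_le_norm x) m)
        (norm_nonneg _)
  filter_upwards [eventually_cocountable_add_nat h, eventually_tendsto_add_nat ht,
    eventually_cocountable_add_nat (eventually_isUnit_smul_one_sub A')] with x hx htx hux
  have hx' : ∀ k : ℕ, Intertwines A A' Q (x + k + 1) := fun k => by
    have := hx (k + 1)
    rwa [Nat.cast_add, Nat.cast_one, ← add_assoc] at this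
  -- Zeros propagate to the left because (x + k) - A' is invertible for generic x.
  have hcast : ∀ k : ℕ, x + (k + 1 : ℕ) = x + k + 1 := fun k => by push_cast; ring
  have hstep : ∀ k : ℕ, Q (x + (k + 1 : ℕ)) = 0 → Q (x + k) = 0 := fun k hk => by
    rw [hcast] at hk
    have h₁ := hx' k
    rw [Intertwines, hk, mul_zero, add_sub_cancel_right] at h₁
    exact (hux k).mul_left_eq_zero.1 h₁
  obtain ⟨k₀, hk₀⟩ := exists_nat_gt (max (2 * a - x.re) (-x.re))
  have hre : ∀ k, k₀ ≤ k → 2 * a < (x + k).re ∧ 0 < (x + k).re := fun k hk => by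
    have : (k₀ : ℝ) ≤ k := by exact_mod_cast hk
    simp only [Complex.add_re, Complex.natCast_re]
    rw [max_lt_iff] at hk₀
    constructor <;> linarith [hk₀.1, hk₀.2]
  -- A nonnegative nondecreasing sequence with limit 0 is zero; this gives the zero at x + k₀, which
  -- is then carried back to x.
  have hmono : Monotone fun k : ℕ => ‖Q (x + (k₀ + k : ℕ))‖ * (x + (k₀ + k : ℕ)).re ^ m := by
    refine monotone_nat_of_le_succ fun k => ?_
    rw [← add_assoc, hcast]
    exact (hx' _).norm_mul_re_pow_le ha (le_max_left _ _) (le_max_right _ _) hm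
      (hre _ (Nat.le_add_right _ _)).1
  have hlim : Tendsto (fun k : ℕ => ‖Q (x + (k₀ + k : ℕ))‖ * (x + (k₀ + k : ℕ)).re ^ m)
      atTop (𝓝 0) :=
    htx.comp (tendsto_atTop_mono (fun k => Nat.le_add_left k k₀) tendsto_id)
  have hz : Q (x + k₀) = 0 := by
    have h₁ := hmono.ge_of_tendsto hlim 0
    have h₂ := pow_pos (hre k₀ le_rfl).2 m
    rw [add_zero] at h₁
    have h₃ : ‖Q (x + k₀)‖ ≤ 0 := by
      by_contra hc
      exact absurd h₁ (not_le.2 (mul_pos (not_le.1 hc) h₂))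
    exact norm_le_zero_iff.1 h₃
  have hall : ∀ k : ℕ, Q (x + k) = 0 → Q x = 0 := fun k => by
    induction k with
    | zero => simp
    | succ k ih => exact fun hk => ih (hstep k hk)
  exact hall k₀ hz

/-! ### Comparison of two solutions in normal form -/

/-- The equation satisfied by the left factor of a solution in normal form. -/
theorem IsNormalFormSolution.eventually_left {lt : ℂ → ℂ → Prop} {B : GL (Fin n) (RatFunc ℂ)}
    {Y M N : ℂ → Matrix (Fin n) (Fin n) ℂ} (h : IsNormalFormSolution lt B Y M N)
    {J : JordanData lt n} (hJ : N =ᶠ[codiscrete ℂ] J.logCar) :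
    ∀ᶠ x in (cocountable : Filter ℂ), M (x - 1) * ((x - 1) • 1 - J.jordan) =
      (x - 1) • ((B : Matrix (Fin n) (Fin n) (RatFunc ℂ)).map
        (RatFunc.eval (RingHom.id ℂ) x) * M x) := by
  have hN := cocountable_le_codiscrete hJ
  have hY := cocountable_le_codiscrete h.factorization
  filter_upwards [hN, eventually_cocountable_sub hN 1, hY, eventually_cocountable_sub hY 1,
    cocountable_le_codiscrete h.solution.2, J.eventually_logCar] with x h₁ h₂ h₃ h₄ h₅ h₆
  rw [h₃, h₄, h₁, h₂] at h₅
  obtain ⟨hu, h₆⟩ := h₆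
  refine hu.mul_right_cancel ?_
  rw [mul_assoc, ← h₆, mul_smul_comm, h₅, smul_mul_assoc, mul_assoc]

/-- Real parts in (0, 1] differ by less than 1, so the only integer difference of eigenvalues is 0.
-/
theorem JordanData.eq_zero_of_sylvester_int {lt : ℂ → ℂ → Prop} (J J' : JordanData lt n) (z : ℤ)
    (B : Matrix (Fin n) (Fin n) ℂ) (hz : z ≠ 0)
    (h : J.jordan * B - B * J'.jordan = (z : ℂ) • B) : B = 0 := by
  ext p q
  refine J.apply_eq_zero_of_sylvester J' h p q fun he => hz ?_
  have h₁ := congrArg Complex.re he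
  have h₂ := J.c_mem (J.blk p)
  have h₃ := J'.c_mem (J'.blk q)
  rw [Complex.sub_re, JordanData.eig, JordanData.eig, Complex.intCast_re] at h₁
  have h₄ : (z : ℝ) < 1 := by linarith
  have h₅ : (-1 : ℝ) < z := by linarith
  have h₄' : z < 1 := by exact_mod_cast h₄
  have h₅' : -1 < z := by exact_mod_cast h₅
  omega

end DifferenceSystem

end

/-! ### Uniqueness of the normal form. -/

open DifferenceSystem in
theorem mainTheorem6 (lt : ℂ → ℂ → Prop) [IsStrictTotalOrder ℂ lt] (n : ℕ)
    (B : GL (Fin n) (RatFunc ℂ)) (hB : IsRegularSingular B)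
    (Y M N Y' M' N' : ℂ → Matrix (Fin n) (Fin n) ℂ)
    (hY : IsNormalFormSolution lt B Y M N) (hY' : IsNormalFormSolution lt B Y' M' N') :
    N' =ᶠ[Filter.codiscrete ℂ] N ∧
    ∃ R : GL (Fin n) ℂ,
      (∀ᶠ x in Filter.codiscrete ℂ,
        (R : Matrix (Fin n) (Fin n) ℂ) * N x = N x * (R : Matrix (Fin n) (Fin n) ℂ)) ∧
      (∀ᶠ x in Filter.codiscrete ℂ, M' x = M x * (R : Matrix (Fin n) (Fin n) ℂ)) := by
  obtain ⟨J, hJ⟩ := hY.right_mem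
  obtain ⟨J', hJ'⟩ := hY'.right_mem
  obtain ⟨hM, W, hW, hMW⟩ := hY.left_mem
  obtain ⟨hM', W', -, hMW'⟩ := hY'.left_mem
  replace hMW := hMW.filter_mono cocountable_le_codiscrete
  replace hMW' := hMW'.filter_mono cocountable_le_codiscrete
  have hQ : ∀ᶠ x in Filter.cocountable,
      Intertwines J.jordan J'.jordan (fun x => W x * M' x) x := by
    filter_upwards [hMW, eventually_cocountable_sub hMW 1, hY.eventually_left hJ,
      hY'.eventually_left hJ'] with x h₁ h₂ h₃ h₄
    have h₅ : M' x = M x * (W x * M' x) := by rw [← mul_assoc, h₁.1, one_mul]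
    rw [Intertwines, mul_assoc, h₄, h₅, ← mul_assoc _ (M x), ← smul_mul_assoc, ← h₃, ← h₅,
      ← mul_assoc (W (x - 1)), ← mul_assoc (W (x - 1)), h₂.2, one_mul]
  obtain ⟨K, hK⟩ := exists_hasPoleExpansion_mul hW hM'
  obtain ⟨C, hJC, hC⟩ := exists_hasExpansion_zero (rightInfinity_le_cocountable hQ)
    (J.eq_zero_of_sylvester_int J') hK
  have hzero := eventually_eq_zero_of_hasExpansion_zero (hQ.mono fun x hx => hx.sub_const hJC) hC
  have hCunit : IsUnit C := by
    have : (Filter.cocountable : Filter ℂ).NeBot :=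
      Filter.NeBot.mono inferInstance rightInfinity_le_cocountable
    obtain ⟨x, h₁, h₂, h₃⟩ := (hzero.and (hMW.and hMW')).exists
    rw [sub_eq_zero] at h₁
    -- At a generic point C = M⁻¹ M', with inverse M'⁻¹ M.
    refine IsUnit.of_mul_eq_one (W' x * M x) ?_
    rw [← h₁, mul_assoc, ← mul_assoc (M' x), h₃.1, one_mul, h₂.2]
  obtain rfl := J.eq_of_intertwine J' hCunit hJC
  obtain ⟨R, rfl⟩ := hCunit
  refine ⟨hJ'.trans hJ.symm, R, ?_, ?_⟩
  · filter_upwards [hJ] with x hx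
    rw [hx]
    exact (J.commute_logCar hJC x).symm.eq
  -- So far M' = M R is known only off a countable set; meromorphy of each entry of the difference
  -- improves this to a codiscrete set.
  · have hij : ∀ i j, ∀ᶠ x in Filter.codiscrete ℂ,
        M' x i j - ∑ k, M x i k * (R : Matrix (Fin n) (Fin n) ℂ) k j = 0 := by
      intro i j
      refine Meromorphic.eventually_codiscrete_eq_zero ?_ ?_
      · refine (hM' i j).1.sub fun x => MeromorphicAt.fun_sum fun k _ => ?_
        exact ((hM i k).1 x).mul (MeromorphicAt.const _ x)
      · filter_upwards [hzero, hMW] with x h₁ h₂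
        rw [sub_eq_zero] at h₁
        rw [← Matrix.mul_apply, ← h₁, ← mul_assoc, h₂.1, one_mul, sub_self]
    filter_upwards [Filter.eventually_all.2 fun i => Filter.eventually_all.2 fun j => hij i j]
      with x hx
    ext i j
    rw [Matrix.mul_apply]
    exact sub_eq_zero.1 (hx i j)
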